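/- Let $n\ge 1$, let $A$ be a real $n\times n$ matrix that is expansive, i.e. all of its complex eigenvalues $\lambda$ satisfy $|\lambda|>1$, and let $\Gamma\subset\mathbb{R}^n$ be a full rank lattice (a discrete subgroup spanning $\mathbb{R}^n$). Then, for some $N\in\mathbb{N}$, $N\ge 1$, there exist an $(A,\Gamma)$-multiresolution analysis $\{V_j\}_{j\in\mathbb{Z}}$ of multiplicity $N$ and Schwartz functions $\varphi^1,\dots,\varphi^N:\mathbb{R}^n\to\mathbb{C}$ belonging to $V_0$ that form a scaling vector of it, such that each Fourier transform $\widehat{\varphi^i}(\xi)=\int_{\mathbb{R}^n}\varphi^i(x)e^{-2\pi i\langle x,\xi\rangle}\,dx$ is a real-valued $C^\infty$ function with compact support. Here an $(A,\Gamma)$-multiresolution analysis of multiplicity $N$ is a sequence $\{V_j\}_{j\in\mathbb{Z}}$ of closed subspaces of the complex Hilbert space $L^2(\mathbb{R}^n)$ such that (M1) $V_j\subset V_{j+1}$ for all $j\in\mathbb{Z}$; (M2) $\bigcap_{j\in\mathbb{Z}}V_j=\{0\}$; (M3) $\overline{\bigcup_{j\in\mathbb{Z}}V_j}=L^2(\mathbb{R}^n)$;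 (M4) for every $f\in L^2(\mathbb{R}^n)$ and every $j\in\mathbb{Z}$, $f\in V_0$ if and only if $f(A^j\,\cdot)\in V_j$; (M5) $V_0$ has a scaling vector, i.e. there are $\varphi^1,\dots,\varphi^N\in V_0$ such that the family $(\varphi^i(\cdot-\gamma))_{\gamma\in\Gamma,\,1\le i\le N}$ is an orthonormal basis of $V_0$. -/

import Mathlib

open MeasureTheory
open scoped FourierTransform SchwartzMap ContDiff ENNReal

/-- `ℝⁿ` with its Euclidean norm and Lebesgue measure. -/
abbrev RSpace (n : ℕ) : Type := EuclideanSpace ℝ (Fin n)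

/-- The complex Hilbert space `L²(ℝⁿ)`. -/
abbrev L2Space (n : ℕ) : Type := Lp ℂ 2 (volume : Measure (RSpace n))

/-- A real square matrix is expansive if all of its (complex) eigenvalues `z` satisfy `|z| > 1`. -/
def IsExpansive {n : ℕ} (A : Matrix (Fin n) (Fin n) ℝ) : Prop :=
  ∀ z : ℂ, Module.End.HasEigenvalue (Matrix.toLin' (A.map (algebraMap ℝ ℂ))) z → 1 < ‖z‖

/-- The translation operator `T_γ f (x) = f (x - γ)` on `L²(ℝⁿ)`. -/
noncomputable def translateL2 {n : ℕ} (γ : RSpace n) (f : L2Space n) : L2Space n :=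
  Lp.compMeasurePreserving (fun x : RSpace n => x - γ) (measurePreserving_sub_right volume γ) f

/-- The system of translates `E^Γ(Φ) = {T_γ φ : γ ∈ Γ, φ ∈ Φ}`, as a family indexed by
`Γ × {1, …, N}`. -/
noncomputable def translates {n N : ℕ} (Γ : Submodule ℤ (RSpace n)) (Φ : Fin N → L2Space n) :
    Γ × Fin N → L2Space n :=
  fun p => translateL2 (p.1 : RSpace n) (Φ p.2)

/-- `Φ = (φ¹, …, φᴺ)` is a scaling vector for the space `W`: each `φⁱ` belongs to `W`, and
`E^Γ(Φ)` is an orthonormal basis of `W`. -/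
structure IsScalingVector {n N : ℕ} (Γ : Submodule ℤ (RSpace n)) (W : Submodule ℂ (L2Space n))
    (Φ : Fin N → L2Space n) : Prop where
  mem : ∀ i, Φ i ∈ W
  orthonormal : Orthonormal ℂ (translates Γ Φ)
  span_eq : (Submodule.span ℂ (Set.range (translates Γ Φ))).topologicalClosure = W

/-- `(V_j)_{j ∈ ℤ}` is a multiresolution analysis of multiplicity `N` associated with the
dilation `A` and the lattice `Γ`. -/
structure IsMRA {n : ℕ} (A : Matrix (Fin n) (Fin n) ℝ) (Γ : Submodule ℤ (RSpace n)) (N : ℕ)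
    (V : ℤ → Submodule ℂ (L2Space n)) : Prop where
  /-- each `V_j` is a closed subspace of `L²(ℝⁿ)` -/
  isClosed : ∀ j, IsClosed (V j : Set (L2Space n))
  /-- the sequence is increasing -/
  mono : ∀ j, V j ≤ V (j + 1)
  /-- the intersection is trivial -/
  inter : ⋂ j, (V j : Set (L2Space n)) = {0}
  /-- the union is dense -/
  union : closure (⋃ j, (V j : Set (L2Space n))) = Set.univ
  /-- `f ∈ V_0` if and only if `f (A^j ·) ∈ V_j`; membership of the function `f (A^j ·)` means that
  its almost everywhere class is an element of `V_j` -/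
  dilation : ∀ (j : ℤ) (f : L2Space n),
    f ∈ V 0 ↔ ∃ g ∈ V j, g =ᵐ[volume] fun x : RSpace n => f (Matrix.toEuclideanLin (A ^ j) x)
  /-- `V_0` has an orthonormal basis of translates of `N` functions -/
  scaling : ∃ Φ : Fin N → L2Space n, IsScalingVector Γ (V 0) Φ

/-! On the frequency side, in coordinates `τ` adapted to `Γ`, translations by `Γ` become
multiplications by characters of `ℝⁿ/ℤⁿ`. A shift-invariant space is then a field of subspaces of
sequences on the cosets `s + ℤⁿ`, and an orthonormal basis of translates is an orthonormal frame of
constant rank `N` in these fibres. Since `A` is expansive, there is a norm `ν` for which the dual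
dilation expands by a factor `l > 1`. If `V₀` contains every function with frequencies in the ball
`ν < r₁`, and has all its frequencies in `ν < l * r₁`, then its dilates form a multiresolution
analysis (`isMRA_comap_dil`).

It remains to find a smooth field of `N`-dimensional fibres between these two balls. The ball `ν ≤
r₁` meets each coset in at most `N` points and the ball `ν < r₃` in at least `N`, provided that `r₃`
exceeds `r₁` by more than twice the bound of `ν` on the unit cube; a large `r₁` makes `r₃ = l * r₁`
suitable. Let `a` be a smooth cutoff, `1` on the small ball and nonzero exactly inside the large
one, and let `t` be a linear functional injective on `ℤⁿ`. On each coset one solves `(1 - a) x + a V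
Vᵀ a x = a r`, where `V` is the Vandermonde matrix of the nodes `t(s + k)` and `r` runs through the
monomials `tⁱ`, `i < N`. The system is uniquely solvable and depends smoothly on `s`; its `N`
solutions are independent, supported where `a ≠ 0`, and span every unit vector at a point where `a =
1` (`exists_interp_family`).

Gram-Schmidt along the cosets (`exists_orthonormal_cosetValues`) turns them into a smooth
orthonormal frame, whose members, rescaled, are the transforms of the scaling functions
(`exists_smooth_frame`). -/

/-! ### Vandermonde systems and the weighted interpolation system. -/

/-- If the first `N` moments of a combination of at most `N` distinct nodes vanish, then so do all
its coefficients. -/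
theorem eq_zero_of_forall_moment_eq_zero {ι : Type*} [DecidableEq ι] {N : ℕ} {s : Finset ι}
    {t : ι → ℝ} (ht : Set.InjOn t s) (hs : s.card ≤ N) {c : ι → ℝ}
    (hc : ∀ i : Fin N, ∑ l ∈ s, c l * t l ^ (i : ℕ) = 0) {k : ι} (hk : k ∈ s) : c k = 0 := by
  have hdeg : (Lagrange.basis s t k).natDegree < N := by
    have h1 := Lagrange.degree_basis ht hk
    have h2 : 0 < s.card := Finset.card_pos.2 ⟨k, hk⟩
    rw [Polynomial.natDegree_eq_of_degree_eq_some h1]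
    omega
  -- Vanishing moments kill the pairing of `c` with every polynomial of degree less than `N`; the
  -- Lagrange polynomial of `k` isolates `c k`.
  have key : ∑ l ∈ s, c l * (Lagrange.basis s t k).eval (t l) = 0 := by
    simp_rw [Polynomial.eval_eq_sum_range' hdeg, Finset.mul_sum]
    rw [Finset.sum_comm]
    refine Finset.sum_eq_zero fun i hi => ?_
    have := hc ⟨i, Finset.mem_range.1 hi⟩
    simp only at this
    calc ∑ l ∈ s, c l * ((Lagrange.basis s t k).coeff i * t l ^ i)
        = (Lagrange.basis s t k).coeff i * ∑ l ∈ s, c l * t l ^ i := by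
          rw [Finset.mul_sum]; exact Finset.sum_congr rfl fun _ _ => by ring
      _ = 0 := by rw [this, mul_zero]
  rw [Finset.sum_eq_single_of_mem k hk] at key
  · rwa [Lagrange.eval_basis_self ht hk, mul_one] at key
  · intro l hl hlk
    rw [Lagrange.eval_basis_of_ne hlk.symm hl, mul_zero]

/-- A polynomial of degree less than `N` vanishing at `N` distinct nodes has zero coefficients. -/
theorem coeff_eq_zero_of_forall_eval_eq_zero {N : ℕ} {s : Finset ℝ} (hs : N ≤ s.card)
    {y : Fin N → ℝ} (hy : ∀ x ∈ s, ∑ i, y i * x ^ (i : ℕ) = 0) : y = 0 := by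
  rcases Nat.eq_zero_or_pos N with rfl | hN
  · exact Subsingleton.elim _ _
  set p : Polynomial ℝ := ∑ i : Fin N, Polynomial.C (y i) * Polynomial.X ^ (i : ℕ) with hp
  have hp0 : p = 0 := by
    refine Polynomial.eq_zero_of_natDegree_lt_card_of_eval_eq_zero' p s (fun x hx => ?_) ?_
    · rw [← hy x hx, hp, Polynomial.eval_finsetSum]
      simp
    · refine lt_of_lt_of_le ?_ hs
      refine lt_of_le_of_lt (Polynomial.natDegree_sum_le_of_forall_le (n := N - 1) _ _ ?_) (by omega)
      intro i _
      exact (Polynomial.natDegree_C_mul_X_pow_le _ _).trans (by omega)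
  funext i
  have := congrArg (fun q => Polynomial.coeff q (i : ℕ)) hp0
  simp only [hp, Polynomial.finsetSum_coeff, Polynomial.coeff_C_mul, Polynomial.coeff_X_pow,
    Polynomial.coeff_zero, Fin.val_inj] at this
  simpa using this

/-- The weighted interpolation system with weights `a`, nodes `t` and right hand side `r`. -/
def SolvesInterp {ι : Type*} (N : ℕ) (a t r x : ι → ℝ) : Prop :=
  ∀ k, (1 - a k) * x k + a k * ∑ i : Fin N, (∑ᶠ l, a l * x l * t l ^ (i : ℕ)) * t k ^ (i : ℕ)
    = a k * r k

section Interp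

variable {ι : Type*} {N : ℕ} {a t : ι → ℝ}

theorem finsum_weight_eq_sum {Φ : Finset ι} (hΦ : ∀ k, a k ≠ 0 → k ∈ Φ) (x : ι → ℝ) (i : ℕ) :
    ∑ᶠ l, a l * x l * t l ^ i = ∑ l ∈ Φ, a l * x l * t l ^ i := by
  refine finsum_eq_sum_of_support_subset _ fun l hl => hΦ l fun h => hl ?_
  simp [h]

theorem SolvesInterp.eq_zero {x r : ι → ℝ} (hx : SolvesInterp N a t r x) {k : ι} (hk : a k = 0) :
    x k = 0 := by
  have := hx k
  simpa [hk] using this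

theorem SolvesInterp.sum_smul {Φ : Finset ι} (hΦ : ∀ k, a k ≠ 0 → k ∈ Φ) {J : Type*} (S : Finset J)
    {x r : J → ι → ℝ} (hx : ∀ j, SolvesInterp N a t (r j) (x j)) (c : J → ℝ) :
    SolvesInterp N a t (fun k => ∑ j ∈ S, c j * r j k) (fun k => ∑ j ∈ S, c j * x j k) := by
  intro k
  simp_rw [finsum_weight_eq_sum hΦ]
  have := fun j => hx j k
  simp_rw [finsum_weight_eq_sum hΦ] at this
  have h2 : ∀ i : Fin N, ∑ l ∈ Φ, a l * (∑ j ∈ S, c j * x j l) * t l ^ (i : ℕ)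
      = ∑ j ∈ S, c j * ∑ l ∈ Φ, a l * x j l * t l ^ (i : ℕ) := by
    intro i
    simp_rw [Finset.mul_sum, Finset.sum_mul]
    rw [Finset.sum_comm]
    exact Finset.sum_congr rfl fun _ _ => Finset.sum_congr rfl fun _ _ => by ring
  simp_rw [h2]
  obtain ⟨m, hm'⟩ : ∃ m : J → Fin N → ℝ,
      ∀ (j : J) (i : Fin N), ∑ l ∈ Φ, a l * x j l * t l ^ (i : ℕ) = m j i := ⟨_, fun _ _ => rfl⟩
  simp only [hm'] at this ⊢
  have hr : a k * ∑ j ∈ S, c j * r j k = ∑ j ∈ S, c j * (a k * r j k) := by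
    rw [Finset.mul_sum]
    exact Finset.sum_congr rfl fun _ _ => by ring
  rw [hr]
  simp_rw [← this, Finset.sum_mul]
  rw [Finset.sum_comm, Finset.mul_sum, Finset.mul_sum, ← Finset.sum_add_distrib]
  refine Finset.sum_congr rfl fun j _ => ?_
  rw [mul_add]
  congr 1
  · ring
  · simp only [Finset.mul_sum]
    exact Finset.sum_congr rfl fun _ _ => by ring

/-- Energy argument: pairing the homogeneous system with `x` gives `∑ (1 - a) x² + |z|² = 0`, where
`z` is the vector of weighted moments. Both terms are nonnegative, so `x` lives where `a = 1` and
its first `N` moments vanish. There are at most `N` such nodes, so `x = 0` by Vandermonde. -/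
theorem SolvesInterp.eq_zero_of_rhs_eq_zero (ha1 : ∀ k, a k ≤ 1)
    (ht : Function.Injective t) {Φ : Finset ι} (hΦ : ∀ k, a k ≠ 0 → k ∈ Φ)
    (hN : {k | a k = 1}.ncard ≤ N) {x r : ι → ℝ} (hx : SolvesInterp N a t r x)
    (hr : ∀ k, a k * r k = 0) : x = 0 := by
  classical
  unfold SolvesInterp at hx
  simp_rw [finsum_weight_eq_sum hΦ, hr] at hx
  set z : Fin N → ℝ := fun i => ∑ l ∈ Φ, a l * x l * t l ^ (i : ℕ) with hz
  have hsum : ∑ k ∈ Φ, (1 - a k) * x k ^ 2 + ∑ i, z i ^ 2 = 0 := by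
    have h1 : ∑ i, z i ^ 2 = ∑ k ∈ Φ, x k * (a k * ∑ i, z i * t k ^ (i : ℕ)) := by
      simp_rw [Finset.mul_sum]
      rw [Finset.sum_comm]
      refine Finset.sum_congr rfl fun i _ => ?_
      rw [sq]
      conv_lhs => rw [hz]
      simp only
      rw [Finset.sum_mul]
      exact Finset.sum_congr rfl fun k _ => by simp only [hz]; ring
    rw [h1, ← Finset.sum_add_distrib]
    refine Finset.sum_eq_zero fun k _ => ?_
    have := hx k
    linear_combination x k * this
  have hp1 : 0 ≤ ∑ k ∈ Φ, (1 - a k) * x k ^ 2 :=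
    Finset.sum_nonneg fun k _ => mul_nonneg (by linarith [ha1 k]) (sq_nonneg _)
  have hp2 : 0 ≤ ∑ i, z i ^ 2 := Finset.sum_nonneg fun i _ => sq_nonneg _
  have hz0 : ∀ i, z i = 0 := by
    intro i
    have : ∑ i, z i ^ 2 = 0 := by linarith
    rw [Finset.sum_eq_zero_iff_of_nonneg fun i _ => sq_nonneg _] at this
    exact pow_eq_zero_iff (two_ne_zero) |>.1 (this i (Finset.mem_univ i))
  have h1 : ∀ k, x k ≠ 0 → a k = 1 := by
    intro k hk
    have := hx k
    change (1 - a k) * x k + a k * ∑ i, z i * t k ^ (i : ℕ) = 0 at this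
    simp only [hz0, zero_mul, Finset.sum_const_zero, mul_zero, add_zero, mul_eq_zero, hk,
      or_false] at this
    linarith
  set s := Φ.filter fun k => a k = 1 with hs
  have hcard : s.card ≤ N := by
    refine le_trans (le_of_eq ?_) hN
    rw [← Set.ncard_coe_finset]
    congr 1
    ext k
    simp only [hs, Finset.coe_filter, Set.mem_ofPred_eq, and_iff_right_iff_imp]
    intro h
    exact hΦ k (by rw [h]; exact one_ne_zero)
  funext k
  by_contra hk
  have hk1 := h1 k hk
  have hks : k ∈ s := by
    simp only [hs, Finset.mem_filter]
    exact ⟨hΦ k (by rw [hk1]; exact one_ne_zero), hk1⟩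
  refine hk (eq_zero_of_forall_moment_eq_zero (ht.injOn) hcard (c := x) (fun i => ?_) hks)
  rw [← hz0 i, hz]
  simp only
  rw [hs, Finset.sum_filter]
  refine Finset.sum_congr rfl fun l _ => ?_
  split_ifs with h
  · rw [h, one_mul]
  · have : x l = 0 := by
      by_contra h'
      exact h (h1 l h')
    simp [this]

theorem SolvesInterp.unique (ha1 : ∀ k, a k ≤ 1)
    (ht : Function.Injective t) {Φ : Finset ι} (hΦ : ∀ k, a k ≠ 0 → k ∈ Φ)
    (hN : {k | a k = 1}.ncard ≤ N) {x x' r : ι → ℝ} (hx : SolvesInterp N a t r x)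
    (hx' : SolvesInterp N a t r x') : x = x' := by
  have h := SolvesInterp.sum_smul hΦ (Finset.univ : Finset (Fin 2)) (x := ![x, x']) (r := ![r, r])
    (by intro j; fin_cases j <;> simpa) ![1, -1]
  have := SolvesInterp.eq_zero_of_rhs_eq_zero ha1 ht hΦ hN h (by intro k; simp)
  funext k
  have h2 := congrFun this k
  simp at h2
  linarith

/-- The matrix of the interpolation system restricted to a finite window `Φ`. -/
def interpMatrix (N : ℕ) (a t : ι → ℝ) (Φ : Finset ι) [DecidableEq ι] : Matrix Φ Φ ℝ :=
  fun k l => (if k = l then 1 - a k else 0) +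
    a k * ∑ i : Fin N, a l * t l ^ (i : ℕ) * t k ^ (i : ℕ)

theorem interpMatrix_mulVec [DecidableEq ι] (Φ : Finset ι) (x : ι → ℝ) (k : Φ) :
    (interpMatrix N a t Φ).mulVec (fun l => x l) k =
      (1 - a k) * x k + a k * ∑ i : Fin N, (∑ l ∈ Φ, a l * x l * t l ^ (i : ℕ)) * t k ^ (i : ℕ) := by
  simp only [Matrix.mulVec, dotProduct, interpMatrix, add_mul, Finset.sum_add_distrib, ite_mul,
    zero_mul, Finset.sum_ite_eq, Finset.mem_univ, if_true]
  congr 1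
  simp_rw [Finset.mul_sum, Finset.sum_mul, Finset.mul_sum]
  rw [Finset.sum_comm]
  refine Finset.sum_congr rfl fun i _ => ?_
  rw [← Finset.sum_coe_sort Φ]
  exact Finset.sum_congr rfl fun _ _ => by ring

theorem solvesInterp_of_mulVec_eq [DecidableEq ι] {Φ : Finset ι} (hΦ : ∀ k, a k ≠ 0 → k ∈ Φ)
    {r : ι → ℝ} {x : ι → ℝ} (hx : ∀ k ∉ Φ, x k = 0)
    (h : (interpMatrix N a t Φ).mulVec (fun l => x l) = fun k : Φ => a k * r k) :
    SolvesInterp N a t r x := by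
  intro k
  by_cases hk : k ∈ Φ
  · have := congrFun h ⟨k, hk⟩
    rw [interpMatrix_mulVec] at this
    simp_rw [finsum_weight_eq_sum hΦ]
    exact this
  · have : a k = 0 := by
      by_contra h'
      exact hk (hΦ k h')
    simp [this, hx k hk]

theorem det_interpMatrix_ne_zero [DecidableEq ι] (ha1 : ∀ k, a k ≤ 1)
    (ht : Function.Injective t) {Φ : Finset ι} (hΦ : ∀ k, a k ≠ 0 → k ∈ Φ)
    (hN : {k | a k = 1}.ncard ≤ N) : (interpMatrix N a t Φ).det ≠ 0 := by
  intro hdet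
  obtain ⟨v, hv, hv0⟩ := Matrix.exists_mulVec_eq_zero_iff.2 hdet
  apply hv
  set x : ι → ℝ := fun k => if h : k ∈ Φ then v ⟨k, h⟩ else 0 with hx
  have hxv : (fun l : Φ => x l) = v := by funext l; simp [hx]
  have hs : SolvesInterp N a t 0 x := by
    refine solvesInterp_of_mulVec_eq hΦ (fun k hk => by simp [hx, hk]) ?_
    rw [hxv, hv0]
    funext k
    simp
  have := SolvesInterp.eq_zero_of_rhs_eq_zero ha1 ht hΦ hN hs (by simp)
  rw [← hxv, this]
  rfl

/-- The solution of the interpolation system is given by Cramer's rule in any finite window. -/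
theorem solvesInterp_cramer [DecidableEq ι] (ha1 : ∀ k, a k ≤ 1)
    (ht : Function.Injective t) {Φ : Finset ι} (hΦ : ∀ k, a k ≠ 0 → k ∈ Φ)
    (hN : {k | a k = 1}.ncard ≤ N) (r : ι → ℝ) :
    SolvesInterp N a t r (fun k => if h : k ∈ Φ then (interpMatrix N a t Φ).det⁻¹ *
      (interpMatrix N a t Φ).cramer (fun k : Φ => a k * r k) ⟨k, h⟩ else 0) := by
  refine solvesInterp_of_mulVec_eq hΦ (fun k hk => by simp [hk]) ?_
  have hd := det_interpMatrix_ne_zero ha1 ht hΦ hN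
  have : (fun l : Φ => if h : (l : ι) ∈ Φ then (interpMatrix N a t Φ).det⁻¹ *
      (interpMatrix N a t Φ).cramer (fun k : Φ => a k * r k) ⟨l, h⟩ else 0)
      = (interpMatrix N a t Φ).det⁻¹ • (interpMatrix N a t Φ).cramer (fun k : Φ => a k * r k) := by
    funext l
    simp
  rw [this, Matrix.mulVec_smul, Matrix.mulVec_cramer, smul_smul, inv_mul_cancel₀ hd, one_smul]

end Interp

/-! ### Integer translates and the smooth interpolating family. -/

/-- The real vector with given integer coordinates. -/
def intVec {n : ℕ} (k : Fin n → ℤ) : Fin n → ℝ := fun j => k j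

section IntVec

variable {n : ℕ}

@[simp] theorem intVec_zero : intVec (0 : Fin n → ℤ) = 0 := by
  funext j; simp [intVec]

theorem intVec_add (k l : Fin n → ℤ) : intVec (k + l) = intVec k + intVec l := by
  funext j; simp [intVec]

theorem intVec_sub (k l : Fin n → ℤ) : intVec (k - l) = intVec k - intVec l := by
  funext j; simp [intVec]

theorem intVec_neg (k : Fin n → ℤ) : intVec (-k) = -intVec k := by
  funext j; simp [intVec]

/-- The box of integer vectors with coordinates of absolute value at most `M`. -/
noncomputable def intBox (n : ℕ) (M : ℤ) : Finset (Fin n → ℤ) := Finset.Icc (fun _ => -M) (fun _ => M)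

theorem mem_intBox_of_norm_le {M : ℤ} {k : Fin n → ℤ} (h : ‖intVec k‖ ≤ M) : k ∈ intBox n M := by
  have h1 : ∀ j, |k j| ≤ M := by
    intro j
    have := (norm_le_pi_norm (intVec k) j).trans h
    simp only [intVec, Real.norm_eq_abs] at this
    exact_mod_cast this
  exact Finset.mem_Icc.2 ⟨fun j => (abs_le.1 (h1 j)).1, fun j => (abs_le.1 (h1 j)).2⟩

/-- Points of `s + ℤⁿ` in the ball of radius `R` correspond to integer vectors in a box. -/
theorem mem_intBox_of_norm_add_le {M : ℤ} {R : ℝ} {s : Fin n → ℝ} {k : Fin n → ℤ}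
    (h : ‖s + intVec k‖ ≤ R) (hM : R + ‖s‖ ≤ M) : k ∈ intBox n M := by
  refine mem_intBox_of_norm_le (le_trans ?_ hM)
  calc ‖intVec k‖ = ‖(s + intVec k) - s‖ := by rw [add_sub_cancel_left]
    _ ≤ R + ‖s‖ := (norm_sub_le _ _).trans (by gcongr)

/-- Makes the finite window of relevant integer vectors constant near `s₀`, so that smoothness can
be checked on finite sums and determinants. -/
theorem exists_int_ge_near (R : ℝ) (s₀ : Fin n → ℝ) :
    ∃ M : ℤ, ∀ᶠ s in nhds s₀, R + ‖s‖ ≤ M := by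
  obtain ⟨M, hM⟩ := exists_int_gt (R + ‖s₀‖)
  refine ⟨M, ?_⟩
  have : Filter.Tendsto (fun s : Fin n → ℝ => R + ‖s‖) (nhds s₀) (nhds (R + ‖s₀‖)) :=
    (continuous_const.add continuous_norm).tendsto s₀
  exact (this.eventually (gt_mem_nhds hM)).mono fun s hs => hs.le

end IntVec

theorem ContDiff.matrixDet {E ι : Type*} [NormedAddCommGroup E] [NormedSpace ℝ E] [Fintype ι]
    [DecidableEq ι] {m : ℕ∞ω} {K : E → Matrix ι ι ℝ} (hK : ∀ i j, ContDiff ℝ m fun s => K s i j) :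
    ContDiff ℝ m fun s => (K s).det := by
  simp_rw [Matrix.det_apply']
  exact ContDiff.sum fun σ _ => contDiff_const.mul (contDiff_prod fun i _ => hK _ _)

/-- The bound `hle` gives unique solvability, and `hge` the independence of the solutions. Where `a`
lies strictly between `0` and `1` the system interpolates between the two regimes, so no choice of
`N` points on a coset, which could not be continuous, is needed. -/
theorem exists_interp_family {n N : ℕ} {a : (Fin n → ℝ) → ℝ} (ha : ContDiff ℝ ∞ a)
    (ha1 : ∀ s, a s ≤ 1) {R : ℝ} (hR : ∀ s, a s ≠ 0 → ‖s‖ ≤ R) (t : (Fin n → ℝ) →ₗ[ℝ] ℝ)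
    (ht : ∀ k : Fin n → ℤ, t (intVec k) = 0 → k = 0)
    (hle : ∀ s, {k | a (s + intVec k) = 1}.ncard ≤ N)
    (hge : ∀ s, N ≤ {k | a (s + intVec k) ≠ 0}.ncard) :
    ∃ f : Fin N → (Fin n → ℝ) → ℝ, (∀ i, ContDiff ℝ ∞ (f i)) ∧ (∀ i s, a s = 0 → f i s = 0) ∧
      (∀ s, LinearIndependent ℝ fun i => fun k => f i (s + intVec k)) ∧
      ∀ s, a s = 1 → Pi.single 0 1 ∈
        Submodule.span ℝ (Set.range fun i => fun k => f i (s + intVec k)) := by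
  classical
  have hbox : ∀ {s : Fin n → ℝ} {M : ℤ}, R + ‖s‖ ≤ M → ∀ k, a (s + intVec k) ≠ 0 → k ∈ intBox n M :=
    fun hM k hk => mem_intBox_of_norm_add_le (hR _ hk) hM
  have hbox' : ∀ s : Fin n → ℝ, ∃ Φ : Finset (Fin n → ℤ), ∀ k, a (s + intVec k) ≠ 0 → k ∈ Φ := by
    intro s
    obtain ⟨M, hM⟩ := exists_int_gt (R + ‖s‖)
    exact ⟨_, hbox hM.le⟩
  have htinj : ∀ s, Function.Injective fun k : Fin n → ℤ => t (s + intVec k) := by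
    intro s k l hkl
    simp only [map_add, add_right_inj] at hkl
    exact sub_eq_zero.1 (ht _ (by rw [intVec_sub, map_sub, hkl, sub_self]))
  have hsol : ∀ (s : Fin n → ℝ) (i : Fin N), ∃ x, SolvesInterp N (fun k => a (s + intVec k))
      (fun k => t (s + intVec k)) (fun k => t (s + intVec k) ^ (i : ℕ)) x := by
    intro s i
    obtain ⟨Φ, hΦ⟩ := hbox' s
    exact ⟨_, solvesInterp_cramer (fun _ => ha1 _) (htinj s) hΦ (hle s) _⟩
  choose X hX using hsol
  -- The systems at `s` and `s + k` differ by relabelling the coset, so uniqueness makes all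
  -- solutions on a coset the values of one function on `ℝⁿ`.
  have hshift : ∀ s i k, X i (s := s + intVec k) 0 = X i (s := s) k := by
    intro s i k
    obtain ⟨Φ, hΦ⟩ := hbox' (s + intVec k)
    have h1 : SolvesInterp N (fun l => a (s + intVec k + intVec l))
      (fun l => t (s + intVec k + intVec l)) (fun l => t (s + intVec k + intVec l) ^ (i : ℕ))
      (fun l => X s i (k + l)) := by
      intro l
      have := hX s i (k + l)
      simp only [intVec_add, ← add_assoc] at this ⊢
      rw [← this]
      congr 2
      refine Finset.sum_congr rfl fun j _ => ?_
      congr 1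
      conv_rhs => rw [← finsum_comp_equiv (Equiv.addLeft k)]
      simp [intVec_add, ← add_assoc]
    have := SolvesInterp.unique (fun _ => ha1 _) (htinj _) hΦ (hle _) (hX (s + intVec k) i) h1
    simpa using congrFun this 0
  have hrow : ∀ s, (fun i => fun k => X (s + intVec k) i 0) = X s := by
    intro s; funext i k; exact hshift s i k
  refine ⟨fun i s => X s i 0, fun i => ?_, fun i s hs => ?_, fun s => ?_, fun s hs => ?_⟩
  · rw [contDiff_iff_contDiffAt]
    intro s₀
    obtain ⟨M₀, hM₀⟩ := exists_int_ge_near R s₀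
    -- The maximum with `0` puts the index `0` in the window.
    set M := max M₀ 0
    have h0 : (0 : Fin n → ℤ) ∈ intBox n M := by
      refine mem_intBox_of_norm_le ?_
      simp [M]
    have hMM : ∀ᶠ s in nhds s₀, R + ‖s‖ ≤ M := hM₀.mono fun s hs => hs.trans (by simp [M])
    have hap : ∀ k : Fin n → ℤ, ContDiff ℝ ∞ fun s : Fin n → ℝ => a (s + intVec k) := fun k =>
      ha.comp (contDiff_id.add contDiff_const)
    have htp : ∀ k : Fin n → ℤ, ContDiff ℝ ∞ fun s : Fin n → ℝ => t (s + intVec k) := fun k =>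
      (LinearMap.toContinuousLinearMap t).contDiff.comp (contDiff_id.add contDiff_const)
    have hK : ∀ k l, ContDiff ℝ ∞ fun s : Fin n → ℝ => interpMatrix N (fun k => a (s + intVec k))
        (fun k => t (s + intVec k)) (intBox n M) k l := by
      intro k l
      unfold interpMatrix
      refine ContDiff.add ?_ ((hap _).mul (ContDiff.sum fun i _ =>
        ((hap _).mul ((htp _).pow _)).mul ((htp _).pow _)))
      split_ifs
      · exact contDiff_const.sub (hap _)
      · exact contDiff_const
    have hev : (fun s => X s i 0) =ᶠ[nhds s₀] fun s =>
        (interpMatrix N (fun k => a (s + intVec k)) (fun k => t (s + intVec k)) (intBox n M)).det⁻¹ *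
        ((interpMatrix N (fun k => a (s + intVec k)) (fun k => t (s + intVec k))
          (intBox n M)).updateCol ⟨0, h0⟩
          (fun k : intBox n M => a (s + intVec k) * t (s + intVec k) ^ (i : ℕ))).det := by
      filter_upwards [hMM] with s hs
      have := SolvesInterp.unique (fun _ => ha1 _) (htinj s) (hbox hs) (hle s) (hX s i)
        (solvesInterp_cramer (fun _ => ha1 _) (htinj s) (hbox hs) (hle s) _)
      rw [this]
      simp only [h0, dif_pos, Matrix.cramer_apply]
    refine ContDiffAt.congr_of_eventuallyEq ?_ hev
    refine ContDiffAt.mul (ContDiffAt.inv (ContDiff.matrixDet hK).contDiffAt ?_) ?_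
    · exact det_interpMatrix_ne_zero (fun _ => ha1 _) (htinj s₀) (hbox hMM.self_of_nhds) (hle s₀)
    · refine (ContDiff.matrixDet fun k l => ?_).contDiffAt
      simp only [Matrix.updateCol_apply]
      split_ifs
      · exact (hap _).mul ((htp _).pow _)
      · exact hK _ _
  · exact (hX s i).eq_zero (by simpa using hs)
  · rw [hrow, Fintype.linearIndependent_iff]
    intro y hy
    obtain ⟨Φ, hΦ⟩ := hbox' s
    have h1 := SolvesInterp.sum_smul hΦ Finset.univ (hX s) y
    have h2 : (fun k => ∑ i, y i * X s i k) = 0 := by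
      rw [← hy]; funext k; simp
    rw [h2] at h1
    -- A relation between the solutions makes the polynomial with coefficients `y` vanish at all
    -- nodes with `a ≠ 0`. There are at least `N` of them and the degree is less than `N`.
    have h3 : ∀ k, a (s + intVec k) ≠ 0 → ∑ i, y i * t (s + intVec k) ^ (i : ℕ) = 0 := by
      intro k hk
      have := h1 k
      simp only [Pi.zero_apply, mul_zero, zero_mul, finsum_zero, Finset.sum_const_zero,
        add_zero] at this
      exact (mul_eq_zero.1 this.symm).resolve_left hk
    set S := (Φ.filter fun k => a (s + intVec k) ≠ 0).image fun k => t (s + intVec k) with hS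
    have hcard : N ≤ S.card := by
      rw [hS, Finset.card_image_of_injective _ (htinj s), ← Set.ncard_coe_finset]
      refine (hge s).trans (le_of_eq ?_)
      congr 1
      ext k
      simp only [Finset.coe_filter, Set.mem_ofPred_eq]
      exact ⟨fun h => ⟨hΦ k h, h⟩, fun h => h.2⟩
    have := coeff_eq_zero_of_forall_eval_eq_zero hcard (y := y) (by
      intro x hx
      simp only [hS, Finset.mem_image, Finset.mem_filter] at hx
      obtain ⟨k, ⟨_, hk⟩, rfl⟩ := hx
      exact h3 k hk)
    exact fun i => congrFun this i
  · rw [hrow]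
    obtain ⟨Φ, hΦ⟩ := hbox' s
    have h1 := SolvesInterp.sum_smul hΦ Finset.univ (hX s) (fun i => t s ^ (i : ℕ))
    -- Where `a s = 1`, the unit vector at `0` has moments `t s ^ i`, so it solves the system whose
    -- right-hand side combines the monomials with these coefficients.
    have h2 : SolvesInterp N (fun k => a (s + intVec k)) (fun k => t (s + intVec k))
        (fun k => ∑ i : Fin N, t s ^ (i : ℕ) * t (s + intVec k) ^ (i : ℕ)) (Pi.single 0 1) := by
      intro k
      have hz : ∀ i : Fin N, ∑ᶠ l, a (s + intVec l) * (Pi.single 0 1 : (Fin n → ℤ) → ℝ) l *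
          t (s + intVec l) ^ (i : ℕ) = t s ^ (i : ℕ) := by
        intro i
        rw [finsum_eq_single _ 0 (fun l hl => by simp [hl])]
        simp [hs]
      simp only [hz]
      by_cases hk : k = 0
      · subst hk; simp [hs]
      · simp [hk]
    have := SolvesInterp.unique (fun _ => ha1 _) (htinj s) hΦ (hle s) h2 h1
    rw [this]
    have h3 : (fun k => ∑ i : Fin N, t s ^ (i : ℕ) * X s i k)
        = ∑ i : Fin N, t s ^ (i : ℕ) • X s i := by
      funext k; simp
    rw [h3]
    exact Submodule.sum_mem _ fun i _ => Submodule.smul_mem _ _ (Submodule.subset_span ⟨i, rfl⟩)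

/-! ### Pairings along cosets and Gram-Schmidt. -/

/-- The pairing of two sequences, one of which is finitely supported. -/
noncomputable def seqPairing {ι : Type*} (u v : ι → ℝ) : ℝ := ∑ᶠ k, u k * v k

/-- The sequence of values of a function on the coset `s + ℤⁿ`. -/
def cosetValues {n : ℕ} (f : (Fin n → ℝ) → ℝ) (s : Fin n → ℝ) : (Fin n → ℤ) → ℝ :=
  fun k => f (s + intVec k)

section

variable {ι : Type*}

theorem seqPairing_eq_sum {Φ : Finset ι} {u v : ι → ℝ} (h : ∀ k, u k ≠ 0 → k ∈ Φ) :
    seqPairing u v = ∑ k ∈ Φ, u k * v k :=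
  finsum_eq_sum_of_support_subset _ fun k hk => h k fun h' => hk (by simp [h'])

theorem seqPairing_comm (u v : ι → ℝ) : seqPairing u v = seqPairing v u :=
  finsum_congr fun _ => mul_comm _ _

theorem seqPairing_smul_left (c : ℝ) (u v : ι → ℝ) :
    seqPairing (c • u) v = c * seqPairing u v := by
  rw [seqPairing, seqPairing, ← smul_eq_mul, smul_finsum]
  exact finsum_congr fun _ => by simp [mul_assoc]

theorem seqPairing_smul_right (c : ℝ) (u v : ι → ℝ) :
    seqPairing u (c • v) = c * seqPairing u v := by
  rw [seqPairing_comm, seqPairing_smul_left, seqPairing_comm]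

theorem seqPairing_self_pos {Φ : Finset ι} {u : ι → ℝ} (h : ∀ k, u k ≠ 0 → k ∈ Φ) (hu : u ≠ 0) :
    0 < seqPairing u u := by
  rw [seqPairing_eq_sum h]
  obtain ⟨k, hk⟩ := Function.ne_iff.1 hu
  exact Finset.sum_pos' (fun _ _ => mul_self_nonneg _) ⟨k, h k hk, mul_self_pos.2 hk⟩

variable {n : ℕ}

/-- Periodicity lets Gram-Schmidt coefficients, which are functions of `s`, act as constants on each
coset. -/
theorem seqPairing_cosetValues_periodic (f g : (Fin n → ℝ) → ℝ) (s : Fin n → ℝ) (k : Fin n → ℤ) :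
    seqPairing (cosetValues f (s + intVec k)) (cosetValues g (s + intVec k))
      = seqPairing (cosetValues f s) (cosetValues g s) := by
  rw [seqPairing, seqPairing]
  conv_rhs => rw [← finsum_comp_equiv (Equiv.addLeft k)]
  simp [cosetValues, intVec_add, add_assoc]

theorem mem_intBox_of_apply_ne_zero {f : (Fin n → ℝ) → ℝ} {R : ℝ} (hR : ∀ s, f s ≠ 0 → ‖s‖ ≤ R)
    {s : Fin n → ℝ} {M : ℤ} (hM : R + ‖s‖ ≤ M) (k : Fin n → ℤ) (hk : cosetValues f s k ≠ 0) :
    k ∈ intBox n M :=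
  mem_intBox_of_norm_add_le (hR _ hk) hM

theorem contDiff_seqPairing_cosetValues {f g : (Fin n → ℝ) → ℝ} {R : ℝ}
    (hR : ∀ s, f s ≠ 0 → ‖s‖ ≤ R) (hf : ContDiff ℝ ∞ f) (hg : ContDiff ℝ ∞ g) :
    ContDiff ℝ ∞ fun s => seqPairing (cosetValues f s) (cosetValues g s) := by
  rw [contDiff_iff_contDiffAt]
  intro s₀
  obtain ⟨M, hM⟩ := exists_int_ge_near R s₀
  have hev : (fun s => seqPairing (cosetValues f s) (cosetValues g s)) =ᶠ[nhds s₀]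
      fun s => ∑ k ∈ intBox n M, f (s + intVec k) * g (s + intVec k) := by
    filter_upwards [hM] with s hs
    exact seqPairing_eq_sum (mem_intBox_of_apply_ne_zero hR hs)
  refine ContDiffAt.congr_of_eventuallyEq (ContDiff.contDiffAt ?_) hev
  exact ContDiff.sum fun k _ => (hf.comp (contDiff_id.add contDiff_const)).mul
    (hg.comp (contDiff_id.add contDiff_const))

/-- Gram-Schmidt orthonormalization along the cosets of `ℤⁿ`. -/
theorem exists_orthonormal_cosetValues {U : Set (Fin n → ℝ)} {R : ℝ} (hR : ∀ s ∈ U, ‖s‖ ≤ R) :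
    ∀ (N : ℕ) (f : Fin N → (Fin n → ℝ) → ℝ), (∀ i, ContDiff ℝ ∞ (f i)) →
      (∀ i, ∀ s ∉ U, f i s = 0) →
      (∀ s, LinearIndependent ℝ fun i => cosetValues (f i) s) →
      ∃ g : Fin N → (Fin n → ℝ) → ℝ, (∀ i, ContDiff ℝ ∞ (g i)) ∧ (∀ i, ∀ s ∉ U, g i s = 0) ∧
        (∀ i j s, seqPairing (cosetValues (g i) s) (cosetValues (g j) s) = if i = j then 1 else 0) ∧
        ∀ s, Submodule.span ℝ (Set.range fun i => cosetValues (g i) s)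
          = Submodule.span ℝ (Set.range fun i => cosetValues (f i) s) := by
  have hUR : ∀ {f : (Fin n → ℝ) → ℝ}, (∀ s ∉ U, f s = 0) → ∀ s, f s ≠ 0 → ‖s‖ ≤ R := by
    intro f hf s hs
    refine hR s ?_
    by_contra h
    exact hs (hf s h)
  intro N
  induction N with
  | zero =>
    intro f _ _ _
    exact ⟨f, fun i => i.elim0, fun i => i.elim0, fun i => i.elim0, fun _ => rfl⟩
  | succ N ih =>
    intro f hf hfU hli
    have hsnoc : ∀ s, (fun i => cosetValues (f i) s)
        = Fin.snoc (fun i : Fin N => cosetValues (f i.castSucc) s)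
          (cosetValues (f (Fin.last N)) s) := by
      intro s
      funext i
      refine Fin.lastCases ?_ (fun i => ?_) i <;> simp
    have hli' := fun s => linearIndependent_finSnoc.1 (hsnoc s ▸ hli s)
    obtain ⟨g, hg, hgU, hgo, hgs⟩ := ih (fun i => f i.castSucc) (fun i => hf _) (fun i => hfU _)
      (fun s => (hli' s).1)
    set F := f (Fin.last N) with hF
    set c : Fin N → (Fin n → ℝ) → ℝ :=
      fun j s => seqPairing (cosetValues F s) (cosetValues (g j) s) with hc
    set h : (Fin n → ℝ) → ℝ := fun s => F s - ∑ j, c j s * g j s with hh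
    have hhU : ∀ s ∉ U, h s = 0 := by
      intro s hs
      simp [hh, hF, hfU _ s hs, hgU _ s hs]
    have hcsm : ∀ j, ContDiff ℝ ∞ (c j) := fun j =>
      contDiff_seqPairing_cosetValues (hUR (hfU _)) (hf _) (hg j)
    have hhsm : ContDiff ℝ ∞ h :=
      (hf _).sub (ContDiff.sum fun j _ => (hcsm j).mul (hg j))
    have hrow : ∀ s, cosetValues h s = cosetValues F s - ∑ j, c j s • cosetValues (g j) s := by
      intro s
      funext k
      simp only [cosetValues, hh, Pi.sub_apply, Finset.sum_apply, Pi.smul_apply, smul_eq_mul]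
      congr 1
      refine Finset.sum_congr rfl fun j _ => ?_
      congr 1
      exact seqPairing_cosetValues_periodic _ _ _ _
    have hgspan : ∀ s j, cosetValues (g j) s ∈
        Submodule.span ℝ (Set.range fun i => cosetValues (g i) s) :=
      fun s j => Submodule.subset_span ⟨j, rfl⟩
    -- Fibrewise independence keeps the new vector away from zero at every `s`, so dividing by its
    -- norm preserves smoothness.
    have hne : ∀ s, cosetValues h s ≠ 0 := by
      intro s h0
      rw [hrow, sub_eq_zero] at h0
      refine (hli' s).2 ?_
      rw [← hgs s, h0]
      exact Submodule.sum_mem _ fun j _ => Submodule.smul_mem _ _ (hgspan s j)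
    have hboxes : ∀ s, ∃ Φ : Finset (Fin n → ℤ), ∀ f : (Fin n → ℝ) → ℝ, (∀ s ∉ U, f s = 0) →
        ∀ k, cosetValues f s k ≠ 0 → k ∈ Φ := by
      intro s
      obtain ⟨M, hM⟩ := exists_int_gt (R + ‖s‖)
      exact ⟨_, fun f hf => mem_intBox_of_apply_ne_zero (hUR hf) hM.le⟩
    have horth : ∀ s j, seqPairing (cosetValues h s) (cosetValues (g j) s) = 0 := by
      intro s j
      obtain ⟨Φ, hΦ⟩ := hboxes s
      have h1 : seqPairing (cosetValues h s) (cosetValues (g j) s)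
          = seqPairing (cosetValues F s) (cosetValues (g j) s) - ∑ i, c i s *
            seqPairing (cosetValues (g i) s) (cosetValues (g j) s) := by
        rw [seqPairing_eq_sum (hΦ h hhU), seqPairing_eq_sum (hΦ F (hfU _)), hrow]
        simp_rw [fun i => seqPairing_eq_sum (v := cosetValues (g j) s) (hΦ (g i) (hgU i)),
          Finset.mul_sum]
        rw [Finset.sum_comm, ← Finset.sum_sub_distrib]
        refine Finset.sum_congr rfl fun k _ => ?_
        simp only [Pi.sub_apply, Finset.sum_apply, Pi.smul_apply, smul_eq_mul, sub_mul,
          Finset.sum_mul, mul_assoc]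
      rw [h1]
      simp [hgo, hc]
    set q : (Fin n → ℝ) → ℝ := fun s => seqPairing (cosetValues h s) (cosetValues h s) with hq
    have hqpos : ∀ s, 0 < q s := by
      intro s
      obtain ⟨Φ, hΦ⟩ := hboxes s
      exact seqPairing_self_pos (hΦ h hhU) (hne s)
    have hqsm : ContDiff ℝ ∞ q := contDiff_seqPairing_cosetValues (hUR hhU) hhsm hhsm
    set G : (Fin n → ℝ) → ℝ := fun s => (√(q s))⁻¹ * h s with hG
    have hGrow : ∀ s, cosetValues G s = (√(q s))⁻¹ • cosetValues h s := by
      intro s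
      funext k
      simp only [cosetValues, hG, Pi.smul_apply, smul_eq_mul]
      congr 3
      exact seqPairing_cosetValues_periodic _ _ _ _
    have hGU : ∀ s ∉ U, G s = 0 := fun s hs => by simp [hG, hhU s hs]
    have hGsm : ContDiff ℝ ∞ G :=
      ((hqsm.sqrt fun s => (hqpos s).ne').inv fun s => (Real.sqrt_pos.2 (hqpos s)).ne').mul hhsm
    have hGG : ∀ s, seqPairing (cosetValues G s) (cosetValues G s) = 1 := by
      intro s
      rw [hGrow, seqPairing_smul_left, seqPairing_smul_right]
      change _ * (_ * q s) = 1
      have h1 := Real.sqrt_pos.2 (hqpos s)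
      have h2 := Real.mul_self_sqrt (hqpos s).le
      field_simp
      nlinarith
    have hGg : ∀ s j, seqPairing (cosetValues G s) (cosetValues (g j) s) = 0 := by
      intro s j
      rw [hGrow, seqPairing_smul_left, horth, mul_zero]
    refine ⟨Fin.snoc g G, fun i => ?_, fun i => ?_, fun i j s => ?_, fun s => ?_⟩
    · refine Fin.lastCases ?_ (fun i => ?_) i <;> simp [hGsm, hg]
    · refine Fin.lastCases ?_ (fun i => ?_) i
      · simpa using hGU
      · simpa using hgU i
    · refine Fin.lastCases ?_ (fun i => ?_) i <;> refine Fin.lastCases ?_ (fun j => ?_) j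
      · simp [hGG]
      · simp [hGg, (Fin.castSucc_lt_last j).ne']
      · simp [seqPairing_comm (cosetValues (g i) s), hGg, (Fin.castSucc_lt_last i).ne]
      · simp [hgo]
    · have hfle : Submodule.span ℝ (Set.range fun i : Fin N => cosetValues (f i.castSucc) s)
          ≤ Submodule.span ℝ (Set.range fun i => cosetValues (f i) s) := by
        refine Submodule.span_mono ?_
        rintro _ ⟨i, rfl⟩
        exact ⟨i.castSucc, rfl⟩
      have hgle : Submodule.span ℝ (Set.range fun i : Fin N => cosetValues (g i) s)
          ≤ Submodule.span ℝ (Set.range fun i =>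
            cosetValues ((Fin.snoc g G : Fin (N + 1) → (Fin n → ℝ) → ℝ) i) s) := by
        refine Submodule.span_mono ?_
        rintro _ ⟨i, rfl⟩
        exact ⟨i.castSucc, by simp⟩
      have hsq : √(q s) ≠ 0 := (Real.sqrt_pos.2 (hqpos s)).ne'
      apply le_antisymm
      · rw [Submodule.span_le]
        rintro _ ⟨i, rfl⟩
        refine Fin.lastCases ?_ (fun i => ?_) i
        · simp only [Fin.snoc_last, SetLike.mem_coe]
          rw [hGrow, hrow]
          refine Submodule.smul_mem _ _ (Submodule.sub_mem _ (Submodule.subset_span ⟨_, rfl⟩)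
            (Submodule.sum_mem _ fun j _ => Submodule.smul_mem _ _ (hfle ?_)))
          rw [← hgs s]
          exact hgspan s j
        · simp only [Fin.snoc_castSucc, SetLike.mem_coe]
          refine hfle ?_
          rw [← hgs s]
          exact hgspan s i
      · rw [Submodule.span_le]
        rintro _ ⟨i, rfl⟩
        refine Fin.lastCases ?_ (fun i => ?_) i
        · have : cosetValues F s = √(q s) • cosetValues G s + ∑ j, c j s • cosetValues (g j) s := by
            rw [hGrow, smul_smul, mul_inv_cancel₀ hsq, one_smul, hrow, sub_add_cancel]
          simp only [SetLike.mem_coe]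
          rw [← hF, this]
          refine Submodule.add_mem _ (Submodule.smul_mem _ _ (Submodule.subset_span
            ⟨Fin.last N, by simp⟩)) (Submodule.sum_mem _ fun j _ => Submodule.smul_mem _ _
              (hgle (hgspan s j)))
        · refine hgle ?_
          rw [hgs s]
          exact Submodule.subset_span ⟨i, rfl⟩

end

/-! ### Smooth frames along the cosets of `ℤⁿ`. -/

/-- There is a linear functional on `ℝⁿ` whose kernel meets `ℤⁿ` only in zero. -/
theorem exists_linearMap_injective_on_intVec (n : ℕ) :
    ∃ t : (Fin n → ℝ) →ₗ[ℝ] ℝ, ∀ k : Fin n → ℤ, t (intVec k) = 0 → k = 0 := by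
  -- A rational basis of `ℝ` is infinite, hence provides `n` rationally independent numbers as
  -- coefficients of `t`.
  let b := Module.Basis.ofVectorSpace ℚ ℝ
  have hinf : Infinite (Module.Basis.ofVectorSpaceIndex ℚ ℝ) := by
    rw [← Cardinal.aleph0_le_mk_iff, b.mk_eq_rank'', Real.rank_rat_real]
    exact Cardinal.aleph0_le_continuum
  let e : Fin n ↪ Module.Basis.ofVectorSpaceIndex ℚ ℝ :=
    Fin.valEmbedding.trans (Infinite.natEmbedding _)
  have hli : LinearIndependent ℚ fun j => b (e j) := b.linearIndependent.comp e e.injective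
  refine ⟨∑ j, (b (e j)) • LinearMap.proj j, fun k hk => ?_⟩
  rw [Fintype.linearIndependent_iff] at hli
  have := hli (fun j => (k j : ℚ)) (by
    rw [← hk]
    simp only [LinearMap.sum_apply, LinearMap.smul_apply, LinearMap.proj_apply, intVec,
      smul_eq_mul, Rat.smul_def, Rat.cast_intCast]
    exact Finset.sum_congr rfl fun _ _ => mul_comm _ _)
  funext j
  exact_mod_cast this j

section Frame

variable {n : ℕ} (ν : Seminorm ℝ (Fin n → ℝ))

theorem finite_setOf_seminorm_add_intVec_le (hle : ∀ x, ‖x‖ ≤ ν x) (r : ℝ) (s : Fin n → ℝ) :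
    {k : Fin n → ℤ | ν (s + intVec k) ≤ r}.Finite := by
  obtain ⟨M, hM⟩ := exists_int_gt (r + ‖s‖)
  exact (intBox n M).finite_toSet.subset fun k hk =>
    mem_intBox_of_norm_add_le ((hle _).trans hk) hM.le

/-- Existence of smooth compactly supported functions whose values along the cosets of `ℤⁿ` are
orthonormal, and span all sequences living in a prescribed ball. -/
theorem exists_smooth_frame (hν : Continuous ν) (hle : ∀ x, ‖x‖ ≤ ν x) {C : ℝ}
    (hC : ∀ x : Fin n → ℝ, (∀ j, 0 ≤ x j ∧ x j ≤ 1) → ν x ≤ C) {r₁ r₃ : ℝ} (hr₁ : 0 ≤ r₁)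
    (hr : r₁ + 2 * C < r₃) :
    ∃ N : ℕ, 1 ≤ N ∧ ∃ g : Fin N → (Fin n → ℝ) → ℝ, (∀ i, ContDiff ℝ ∞ (g i)) ∧
      (∀ i s, r₃ ≤ ν s → g i s = 0) ∧
      (∀ i j s, seqPairing (cosetValues (g i) s) (cosetValues (g j) s) = if i = j then 1 else 0) ∧
      ∀ s, ν s ≤ r₁ → ∀ k, ∑ i, g i s * g i (s + intVec k) = if k = 0 then 1 else 0 := by
  have hC0 : 0 ≤ C := by simpa using hC 0 (by simp)
  have hdisj : Disjoint {s | r₃ ≤ ν s} {s | ν s ≤ r₁} := by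
    rw [Set.disjoint_left]
    intro s hs hs'
    simp only [Set.mem_ofPred_eq] at hs hs'
    linarith
  -- The level sets `a = 0` and `a = 1` are prescribed exactly, since both are counted on each
  -- coset.
  obtain ⟨a, ha, hrange, hzero, hone⟩ := exists_contMDiff_zero_iff_one_iff_of_isClosed
    (modelWithCornersSelf ℝ (Fin n → ℝ)) (n := ⊤) (isClosed_le continuous_const hν)
    (isClosed_le hν continuous_const) hdisj
  have ha' : ContDiff ℝ ∞ a := contMDiff_iff_contDiff.1 ha
  simp only [Set.mem_ofPred_eq] at hzero hone
  obtain ⟨t, ht⟩ := exists_linearMap_injective_on_intVec n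
  -- Moving `s` to a lattice point costs at most `C`. Hence the `r₁`-ball on any coset injects into
  -- this set, and this set injects into the points with `ν ≤ r₁ + 2 * C < r₃`.
  set N := {k : Fin n → ℤ | ν (intVec k) ≤ r₁ + C}.ncard with hN
  have hfin : {k : Fin n → ℤ | ν (intVec k) ≤ r₁ + C}.Finite := by
    simpa using finite_setOf_seminorm_add_intVec_le ν hle (r₁ + C) 0
  have hfl : ∀ s : Fin n → ℝ, ∃ m : Fin n → ℤ, ν (s - intVec m) ≤ C := by
    intro s
    refine ⟨fun j => ⌊s j⌋, hC _ fun j => ?_⟩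
    simp only [intVec, Pi.sub_apply, Int.self_sub_floor]
    exact ⟨Int.fract_nonneg _, (Int.fract_lt_one _).le⟩
  have hasupp : ∀ s, a s ≠ 0 → ν s < r₃ := fun s hs => by
    by_contra h
    exact hs ((hzero s).1 (not_lt.1 h))
  obtain ⟨f, hf, hfa, hfli, hfs⟩ := exists_interp_family (N := N) ha'
    (fun s => (hrange ⟨s, rfl⟩).2) (R := r₃) (fun s hs => (hle s).trans (hasupp s hs).le) t ht
    (by
      intro s
      obtain ⟨m, hm⟩ := hfl s
      refine Set.ncard_le_ncard_of_injOn (fun k => k + m) (fun k hk => ?_)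
        (add_left_injective m).injOn hfin
      have hk1 := (hone _).2 hk
      calc ν (intVec (k + m)) = ν ((s + intVec k) - (s - intVec m)) := by
            rw [intVec_add]; congr 1; abel
        _ ≤ ν (s + intVec k) + ν (s - intVec m) := map_sub_le_add _ _ _
        _ ≤ r₁ + C := add_le_add hk1 hm)
    (by
      intro s
      obtain ⟨m, hm⟩ := hfl s
      refine Set.ncard_le_ncard_of_injOn (fun k => k - m) (fun k hk => ?_)
        (sub_left_injective).injOn
        ((finite_setOf_seminorm_add_intVec_le ν hle r₃ s).subset fun k hk => (hasupp _ hk).le)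
      simp only [Set.mem_ofPred_eq] at hk ⊢
      rw [Ne, ← hzero, not_le]
      calc ν (s + intVec (k - m)) = ν (intVec k + (s - intVec m)) := by
            rw [intVec_sub]; congr 1; abel
        _ ≤ ν (intVec k) + ν (s - intVec m) := map_add_le_add _ _ _
        _ < r₃ := by linarith)
  obtain ⟨g, hg, hgU, hgo, hgs⟩ := exists_orthonormal_cosetValues (U := {s | a s ≠ 0}) (R := r₃)
    (fun s hs => (hle s).trans (hasupp s hs).le) N f hf
    (fun i s hs => hfa i s (by simpa using hs)) hfli
  have hgz : ∀ i s, r₃ ≤ ν s → g i s = 0 := by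
    intro i s hs
    refine hgU i s ?_
    simpa using (hzero s).1 hs
  refine ⟨N, ?_, g, hg, hgz, hgo, fun s hs k => ?_⟩
  · rw [hN, Nat.one_le_iff_ne_zero, ← Nat.pos_iff_ne_zero, Set.ncard_pos hfin]
    exact ⟨0, by simp; linarith⟩
  · have h1 := hfs s ((hone s).1 hs)
    change _ ∈ Submodule.span ℝ (Set.range fun i => cosetValues (f i) s) at h1
    rw [← hgs s, Submodule.mem_span_range_iff_exists_fun] at h1
    obtain ⟨c, hc⟩ := h1
    obtain ⟨M, hM⟩ := exists_int_gt (r₃ + ‖s‖)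
    have hΦ : ∀ i k, cosetValues (g i) s k ≠ 0 → k ∈ intBox n M := fun i =>
      mem_intBox_of_apply_ne_zero (fun x hx => (hle x).trans
        (le_of_not_ge fun h => hx (hgz i x h))) hM.le
    -- The coefficients of the unit vector at `0` in the orthonormal frame are its pairings with the
    -- frame.
    have hci : ∀ i, c i = g i s := by
      intro i
      have h2 : seqPairing (cosetValues (g i) s) (Pi.single 0 1) = g i s := by
        rw [seqPairing, finsum_eq_single _ 0 (fun l hl => by simp [hl])]
        simp [cosetValues]
      have h3 : seqPairing (cosetValues (g i) s) (∑ j, c j • cosetValues (g j) s)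
          = ∑ j, c j * seqPairing (cosetValues (g i) s) (cosetValues (g j) s) := by
        simp_rw [seqPairing_eq_sum (hΦ i), Finset.mul_sum]
        rw [Finset.sum_comm]
        refine Finset.sum_congr rfl fun l _ => ?_
        rw [Finset.sum_apply, Finset.mul_sum]
        exact Finset.sum_congr rfl fun j _ => by
          simp only [Pi.smul_apply, smul_eq_mul]; ring
      rw [← h2, ← hc, h3]
      simp [hgo]
    have h4 := congrFun hc k
    rw [Finset.sum_apply] at h4
    simp only [hci, Pi.smul_apply, smul_eq_mul, cosetValues, Pi.single_apply] at h4
    exact h4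

end Frame

/-! ### Expansive matrices and adapted norms. -/

/-- By Gelfand's formula, `‖a ^ m‖ < r ^ m` eventually, for any `r < 1` above the spectral radius.
-/
theorem tendsto_pow_zero_of_spectrum_lt_one {B : Type*} [NormedRing B] [NormedAlgebra ℂ B]
    [CompleteSpace B] [Nontrivial B] (a : B) (ha : ∀ z ∈ spectrum ℂ a, ‖z‖ < 1) :
    Filter.Tendsto (fun m => a ^ m) Filter.atTop (nhds 0) := by
  have h1 : spectralRadius ℂ a < (1 : NNReal) :=
    spectrum.spectralRadius_lt_of_forall_lt a fun z hz => by
      exact_mod_cast ha z hz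
  obtain ⟨r, hr1, hr2⟩ := ENNReal.lt_iff_exists_nnreal_btwn.1 h1
  have hr : r < 1 := by exact_mod_cast hr2
  have h2 := (spectrum.pow_nnnorm_pow_one_div_tendsto_nhds_spectralRadius a).eventually
    (gt_mem_nhds hr1)
  refine squeeze_zero_norm' (a := fun m => (r : ℝ) ^ m) ?_
    (tendsto_pow_atTop_nhds_zero_of_lt_one r.2 (by exact_mod_cast hr))
  filter_upwards [h2, Filter.eventually_gt_atTop 0] with m hm hm0
  have hm0' : (0 : ℝ) < m := by exact_mod_cast hm0
  have h3 := ENNReal.rpow_le_rpow hm.le hm0'.le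
  rw [← ENNReal.rpow_mul, one_div, inv_mul_cancel₀ hm0'.ne', ENNReal.rpow_one,
    ENNReal.rpow_natCast] at h3
  exact_mod_cast h3

section

attribute [local instance] Matrix.linftyOpNormedRing Matrix.linftyOpNormedAlgebra

theorem IsExpansive.isUnit_map {n : ℕ} {A : Matrix (Fin n) (Fin n) ℝ} (hA : IsExpansive A) :
    IsUnit (A.map (algebraMap ℝ ℂ)) := by
  rw [← spectrum.zero_notMem_iff ℂ, ← Matrix.spectrum_toLin',
    ← Module.End.hasEigenvalue_iff_mem_spectrum]
  intro h
  have := hA 0 h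
  rw [norm_zero] at this
  exact absurd this (by norm_num)

theorem IsExpansive.isUnit_det {n : ℕ} {A : Matrix (Fin n) (Fin n) ℝ} (hA : IsExpansive A) :
    IsUnit A.det := by
  have h := (Matrix.isUnit_iff_isUnit_det _).1 hA.isUnit_map
  rw [← RingHom.mapMatrix_apply, ← RingHom.map_det] at h
  exact (isUnit_map_iff _ _).1 h

theorem IsExpansive.tendsto_inv_pow {n : ℕ} (hn : 1 ≤ n) {A : Matrix (Fin n) (Fin n) ℝ}
    (hA : IsExpansive A) : Filter.Tendsto (fun m => A⁻¹ ^ m) Filter.atTop (nhds 0) := by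
  have : Nonempty (Fin n) := ⟨⟨0, hn⟩⟩
  obtain ⟨u, hu⟩ := hA.isUnit_map
  have h1 : ∀ z ∈ spectrum ℂ (↑u⁻¹ : Matrix (Fin n) (Fin n) ℂ), ‖z‖ < 1 := by
    intro z hz
    have hz0 : z ≠ 0 := by
      rintro rfl
      exact spectrum.zero_notMem ℂ (u⁻¹).isUnit hz
    lift z to ℂˣ using hz0.isUnit
    rw [← inv_inv z, ← spectrum.inv_mem_iff, hu, ← Matrix.spectrum_toLin',
      ← Module.End.hasEigenvalue_iff_mem_spectrum] at hz
    have := hA _ hz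
    rw [Units.val_inv_eq_inv_val, norm_inv] at this
    exact (one_lt_inv₀ (norm_pos_iff.2 z.ne_zero)).1 this
  have h2 := tendsto_pow_zero_of_spectrum_lt_one _ h1
  have h3 : (↑u⁻¹ : Matrix (Fin n) (Fin n) ℂ) = A⁻¹.map (algebraMap ℝ ℂ) := by
    refine (Units.eq_inv_of_mul_eq_one_right ?_).symm
    rw [hu, ← Matrix.map_mul, Matrix.nonsing_inv_mul _ hA.isUnit_det]
    exact Matrix.map_one _ (map_zero _) (map_one _)
  refine tendsto_pi_nhds.2 fun i => tendsto_pi_nhds.2 fun j => ?_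
  have h4 := (tendsto_pi_nhds.1 (tendsto_pi_nhds.1 h2 i) j)
  have h5 : ∀ m, ((↑u⁻¹ : Matrix (Fin n) (Fin n) ℂ) ^ m) i j = (((A⁻¹ ^ m) i j : ℝ) : ℂ) := by
    intro m
    rw [h3, ← RingHom.mapMatrix_apply, ← map_pow]
    rfl
  simp_rw [h5] at h4
  exact_mod_cast (Complex.continuous_re.tendsto _).comp h4

end

/-- A linear map with a strictly contracting power is strictly contracting for a suitable norm. -/
theorem exists_adapted_seminorm {X : Type*} [NormedAddCommGroup X] [NormedSpace ℝ X]
    (D : X →L[ℝ] X) {m : ℕ} (hm : 1 ≤ m) (hD : ∀ x, 2 * ‖(D ^ m) x‖ ≤ ‖x‖) :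
    ∃ l : ℝ, 1 < l ∧ ∃ ν : Seminorm ℝ X, Continuous ν ∧ (∀ x, ‖x‖ ≤ ν x) ∧
      ∀ x, l * ν (D x) ≤ ν x := by
  set l : NNReal := (2 : NNReal) ^ ((m : ℝ)⁻¹) with hl
  have hlm : l ^ m = 2 := NNReal.rpow_inv_natCast_pow _ (by omega)
  have hl1 : 1 < l := NNReal.one_lt_rpow one_lt_two (by positivity)
  -- With `l ^ m = 2`, the sum for `l * ν (D x)` is the sum for `ν x` shifted by one: it loses `‖x‖`
  -- and gains `2 * ‖(D ^ m) x‖`, which is no larger.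
  set ν : Seminorm ℝ X := ∑ j ∈ Finset.range m,
    (l ^ j) • (normSeminorm ℝ X).comp ((D ^ j : X →L[ℝ] X) : X →ₗ[ℝ] X) with hν
  have happ : ∀ x, ν x = ∑ j ∈ Finset.range m, (l : ℝ) ^ j * ‖(D ^ j) x‖ := by
    intro x
    rw [hν, ← FunLike.coeAddMonoidHom_apply, map_sum, Finset.sum_apply]
    refine Finset.sum_congr rfl fun j _ => ?_
    change (l ^ j) • ‖(D ^ j) x‖ = _
    rw [NNReal.smul_def, smul_eq_mul, NNReal.coe_pow]
  refine ⟨l, by exact_mod_cast hl1, ν, ?_, fun x => ?_, fun x => ?_⟩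
  · have : (ν : X → ℝ) = fun x => ∑ j ∈ Finset.range m, (l : ℝ) ^ j * ‖(D ^ j) x‖ := funext happ
    rw [this]
    fun_prop
  · rw [happ]
    refine le_trans (le_of_eq ?_) (Finset.single_le_sum (f := fun j => (l : ℝ) ^ j * ‖(D ^ j) x‖)
      (fun j _ => by positivity) (Finset.mem_range.2 hm))
    simp
  · rw [happ, happ, Finset.mul_sum]
    have h1 : ∑ j ∈ Finset.range m, (l : ℝ) * ((l : ℝ) ^ j * ‖(D ^ j) (D x)‖)
        = ∑ j ∈ Finset.range m, (l : ℝ) ^ (j + 1) * ‖(D ^ (j + 1)) x‖ := by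
      refine Finset.sum_congr rfl fun j _ => ?_
      rw [pow_succ D]
      simp only [mul_apply_eq_comp]
      ring
    have h2 := Finset.sum_range_succ (fun j => (l : ℝ) ^ j * ‖(D ^ j) x‖) m
    have h3 := Finset.sum_range_succ' (fun j => (l : ℝ) ^ j * ‖(D ^ j) x‖) m
    have h4 : (l : ℝ) ^ m = 2 := by exact_mod_cast hlm
    have h5 := hD x
    simp only [pow_zero, one_mul, one_apply_eq_self] at h3
    rw [h1]
    rw [h4] at h2
    linarith

/-! ### Dilations and translations of `L²` under the Fourier transform. -/

section Dilation

variable {E F : Type*} [NormedAddCommGroup E] [InnerProductSpace ℝ E] [FiniteDimensional ℝ E]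
  [MeasurableSpace E] [BorelSpace E]

/-- Linear equivalences scale Haar measures. -/
theorem exists_map_eq_smul_volume [NormedAddCommGroup F] [NormedSpace ℝ F] [FiniteDimensional ℝ F]
    [MeasureSpace F] [BorelSpace F] [(volume : Measure F).IsAddHaarMeasure] (M : E ≃L[ℝ] F) :
    ∃ c : ℝ≥0∞, c ≠ 0 ∧ c ≠ ⊤ ∧ (volume : Measure E).map M = c • (volume : Measure F) := by
  have : ((volume : Measure E).map M).IsAddHaarMeasure := M.isAddHaarMeasure_map _
  refine ⟨((volume : Measure E).map M).addHaarScalarFactor volume, ?_, ENNReal.coe_ne_top,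
    Measure.isAddLeftInvariant_eq_smul _ _⟩
  exact_mod_cast (Measure.addHaarScalarFactor_pos_of_isAddHaarMeasure _ _).ne'

theorem ContinuousLinearEquiv.quasiMeasurePreserving [NormedAddCommGroup F] [NormedSpace ℝ F]
    [FiniteDimensional ℝ F] [MeasureSpace F] [BorelSpace F]
    [(volume : Measure F).IsAddHaarMeasure] (M : E ≃L[ℝ] F) :
    Measure.QuasiMeasurePreserving M (volume : Measure E) (volume : Measure F) := by
  obtain ⟨c, hc0, hct, hc⟩ := exists_map_eq_smul_volume M
  refine ⟨M.continuous.measurable, ?_⟩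
  rw [hc]
  exact Measure.smul_absolutelyContinuous

theorem eLpNorm_comp_continuousLinearEquiv (M : E ≃L[ℝ] E) :
    ∃ c : ℝ≥0∞, c ≠ ⊤ ∧ ∀ f : E → ℂ, AEStronglyMeasurable f volume →
      eLpNorm (f ∘ M) 2 volume = c * eLpNorm f 2 volume := by
  obtain ⟨c, hc0, hct, hc⟩ := exists_map_eq_smul_volume M
  refine ⟨c ^ (1 / (2 : ℝ≥0∞)).toReal, by simp [hct], fun f hf => ?_⟩
  rw [← eLpNorm_map_measure (f := M) (g := f) (by
    rw [hc]; exact hf.mono_ac Measure.smul_absolutelyContinuous) M.continuous.aemeasurable, hc,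
    eLpNorm_smul_measure_of_ne_top ENNReal.ofNat_ne_top, smul_eq_mul]

theorem MeasureTheory.Lp.memLp_comp_continuousLinearEquiv (M : E ≃L[ℝ] E)
    (f : Lp ℂ 2 (volume : Measure E)) : MemLp (f ∘ M) 2 (volume : Measure E) := by
  obtain ⟨c, hc, h⟩ := eLpNorm_comp_continuousLinearEquiv M
  refine ⟨(Lp.aestronglyMeasurable f).comp_quasiMeasurePreserving M.quasiMeasurePreserving, ?_⟩
  rw [h f (Lp.aestronglyMeasurable f)]
  exact ENNReal.mul_lt_top hc.lt_top (Lp.eLpNorm_lt_top f)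

/-- Composition with a linear equivalence as a bounded operator on `L²`. -/
noncomputable def compL2 (M : E ≃L[ℝ] E) :
    Lp ℂ 2 (volume : Measure E) →L[ℂ] Lp ℂ 2 (volume : Measure E) :=
  LinearMap.mkContinuousOfExistsBound
    { toFun := fun f => (Lp.memLp_comp_continuousLinearEquiv M f).toLp _
      map_add' := fun f g => by
        rw [← MemLp.toLp_add]
        refine MemLp.toLp_congr _ _ ?_
        exact M.quasiMeasurePreserving.ae_eq_comp (Lp.coeFn_add f g)
      map_smul' := fun c f => by
        rw [RingHom.id_apply, ← MemLp.toLp_const_smul]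
        refine MemLp.toLp_congr _ _ ?_
        exact M.quasiMeasurePreserving.ae_eq_comp (Lp.coeFn_smul c f) }
    (by
      obtain ⟨c, hc, h⟩ := eLpNorm_comp_continuousLinearEquiv M
      refine ⟨c.toReal, fun f => ?_⟩
      simp only [LinearMap.coe_mk, AddHom.coe_mk, Lp.norm_toLp]
      rw [h f (Lp.aestronglyMeasurable f), ENNReal.toReal_mul, Lp.norm_def])

theorem coeFn_compL2 (M : E ≃L[ℝ] E) (f : Lp ℂ 2 (volume : Measure E)) :
    compL2 M f =ᵐ[volume] f ∘ M :=
  (Lp.memLp_comp_continuousLinearEquiv M f).coeFn_toLp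

theorem compL2_toLp (M : E ≃L[ℝ] E) (f : 𝓢(E, ℂ)) :
    compL2 M (f.toLp 2 volume)
      = (SchwartzMap.compCLMOfContinuousLinearEquiv ℂ M f).toLp 2 volume := by
  refine Lp.ext ?_
  filter_upwards [coeFn_compL2 M (f.toLp 2 volume),
    M.quasiMeasurePreserving.ae_eq_comp (f.coeFn_toLp 2 volume),
    (SchwartzMap.compCLMOfContinuousLinearEquiv ℂ M f).coeFn_toLp 2 volume] with x h1 h2 h3
  rw [h1, h2, h3]
  rfl

/-- The Fourier transform intertwines composition with `M` and with the contragredient of `M`. -/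
theorem exists_fourier_compL2 (M M' : E ≃L[ℝ] E) (h : ∀ x ξ, inner ℝ (M x) (M' ξ) = inner ℝ x ξ) :
    ∃ c : ℝ, ∀ f : Lp ℂ 2 (volume : Measure E), 𝓕 (compL2 M f) = (c : ℂ) • compL2 M' (𝓕 f) := by
  obtain ⟨c, hc0, hct, hc⟩ := exists_map_eq_smul_volume M
  refine ⟨c.toReal, fun f => ?_⟩
  refine DenseRange.induction_on (p := fun f : Lp ℂ 2 (volume : Measure E) =>
    𝓕 (compL2 M f) = (c.toReal : ℂ) • compL2 M' (𝓕 f))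
    (SchwartzMap.denseRange_toLpCLM (p := 2) ENNReal.ofNat_ne_top) f ?_ ?_
  · refine isClosed_eq ?_ ?_
    · exact (Lp.fourierTransformₗᵢ E ℂ).continuous.comp (compL2 M).continuous
    · exact (((c.toReal : ℂ) • compL2 M').continuous.comp
        (Lp.fourierTransformₗᵢ E ℂ).continuous)
  · intro φ
    rw [SchwartzMap.toLpCLM_apply, compL2_toLp, SchwartzMap.toLp_fourier_eq,
      SchwartzMap.toLp_fourier_eq, compL2_toLp]
    have : 𝓕 (SchwartzMap.compCLMOfContinuousLinearEquiv ℂ M φ)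
        = (c.toReal : ℂ) • SchwartzMap.compCLMOfContinuousLinearEquiv ℂ M' (𝓕 φ) := by
      ext ξ
      rw [SchwartzMap.fourier_coe, Real.fourier_eq]
      simp only [SchwartzMap.compCLMOfContinuousLinearEquiv_apply, Function.comp_apply,
        smul_apply]
      rw [SchwartzMap.fourier_coe, Real.fourier_eq]
      have h1 : ∀ x, inner ℝ x ξ = inner ℝ (M x) (M' ξ) := fun x => (h x ξ).symm
      simp_rw [h1]
      have h2 := M.toHomeomorph.measurableEmbedding.integral_map (μ := volume)
        (fun y => Real.fourierChar (-inner ℝ y (M' ξ)) • φ y)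
      simp only [ContinuousLinearEquiv.coe_toHomeomorph] at h2
      rw [← h2, hc, integral_smul_measure]
      simp
    rw [this]
    exact ((SchwartzMap.toLpCLM ℂ ℂ 2 volume).map_smul _ _)

end Dilation

section Translation

variable {n : ℕ}

theorem translateL2_toLp (γ : RSpace n) (f : 𝓢(RSpace n, ℂ)) :
    translateL2 γ (f.toLp 2 volume) = (SchwartzMap.compSubConstCLM ℂ γ f).toLp 2 volume := by
  refine Lp.ext ?_
  have hmp := measurePreserving_sub_right (volume : Measure (RSpace n)) γ
  filter_upwards [Lp.coeFn_compMeasurePreserving (f.toLp 2 volume) hmp,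
    hmp.quasiMeasurePreserving.ae_eq_comp (f.coeFn_toLp 2 volume),
    (SchwartzMap.compSubConstCLM ℂ γ f).coeFn_toLp 2 volume] with x h1 h2 h3
  rw [translateL2, h1, h2, h3]
  rfl

theorem fourier_compSubConstCLM (γ : RSpace n) (f : 𝓢(RSpace n, ℂ)) (ξ : RSpace n) :
    𝓕 (SchwartzMap.compSubConstCLM ℂ γ f) ξ
      = (Real.fourierChar (-inner ℝ γ ξ) : ℂ) * 𝓕 f ξ := by
  have := congrFun (VectorFourier.fourierIntegral_comp_add_right Real.fourierChar
    (volume : Measure (RSpace n)) (innerₗ (RSpace n)) f (-γ)) ξ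
  rw [SchwartzMap.fourier_coe, SchwartzMap.fourier_coe]
  simp only [map_neg, LinearMap.neg_apply, innerₗ_apply_apply, Circle.smul_def, smul_eq_mul] at this
  exact this

/-- The Fourier transform turns translation of Schwartz functions into modulation. -/
theorem coeFn_fourier_translateL2 (γ : RSpace n) (f : 𝓢(RSpace n, ℂ)) :
    (𝓕 (translateL2 γ (f.toLp 2 volume)) : L2Space n) =ᵐ[volume]
      fun ξ => (Real.fourierChar (-inner ℝ γ ξ) : ℂ) * 𝓕 f ξ := by
  rw [translateL2_toLp, SchwartzMap.toLp_fourier_eq]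
  filter_upwards [(𝓕 (SchwartzMap.compSubConstCLM ℂ γ f)).coeFn_toLp 2 volume] with ξ hξ
  rw [hξ, fourier_compSubConstCLM]

end Translation

/-! ### The torus and unfolding of integrals. -/

section Torus

variable {n : ℕ}

/-- The projection of `ℝⁿ` onto the torus `ℝⁿ / ℤⁿ`. -/
def torusMk (s : Fin n → ℝ) : UnitAddTorus (Fin n) := fun i => (s i : UnitAddCircle)

theorem isOpenQuotientMap_torusMk : IsOpenQuotientMap (torusMk (n := n)) :=
  IsOpenQuotientMap.piMap fun _ => QuotientAddGroup.isOpenQuotientMap_mk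

theorem torusMk_add_intVec (s : Fin n → ℝ) (k : Fin n → ℤ) :
    torusMk (s + intVec k) = torusMk s := by
  funext i
  have := AddCircle.coe_add_period (1 : ℝ)
  simp only [torusMk, intVec, Pi.add_apply, AddCircle.coe_add, add_eq_left]
  rw [AddCircle.coe_eq_zero_iff]
  exact ⟨k i, by simp⟩

theorem exists_eq_add_intVec_of_torusMk_eq {s s' : Fin n → ℝ} (h : torusMk s = torusMk s') :
    ∃ k, s' = s + intVec k := by
  have h1 : ∀ i, ∃ k : ℤ, s' i = s i + k := by
    intro i
    have h2 : ((s' i - s i : ℝ) : UnitAddCircle) = 0 := by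
      rw [AddCircle.coe_sub, sub_eq_zero]
      exact (congrFun h i).symm
    obtain ⟨k, hk⟩ := (AddCircle.coe_eq_zero_iff _).1 h2
    simp only [zsmul_eq_mul, mul_one] at hk
    exact ⟨k, by rw [hk]; ring⟩
  choose k hk using h1
  exact ⟨k, funext hk⟩

/-- The half-open unit cube. -/
def unitCube (n : ℕ) : Set (Fin n → ℝ) :=
  {x | ∀ i, x i ∈ Set.Ioc ((0 : Fin n → ℝ) i) ((0 : Fin n → ℝ) i + 1)}

theorem setIntegral_unitCube_mFourier (m : Fin n → ℤ) :
    ∫ s in unitCube n, UnitAddTorus.mFourier m (torusMk s) = if m = 0 then 1 else 0 := by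
  have h := orthonormal_iff_ite.1 (UnitAddTorus.orthonormal_mFourier (d := Fin n)) 0 m
  simp only [ContinuousMap.inner_toLp, UnitAddTorus.mFourier_zero] at h
  have h2 := UnitAddTorus.integral_preimage (UnitAddTorus.mFourier m) 0
  refine h2.symm.trans (Eq.trans ?_ (h.trans (if_congr eq_comm rfl rfl)))
  simp

/-- Unfolding of integrals over `ℝⁿ` over the unit cube. -/
theorem integral_eq_setIntegral_unitCube {F : (Fin n → ℝ) → ℂ} (hF : Continuous F) {R : ℝ}
    (hR : ∀ s, F s ≠ 0 → ‖s‖ ≤ R) :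
    ∫ s, F s = ∫ s in unitCube n, ∑ᶠ k, F (s + intVec k) := by
  obtain ⟨M, hM⟩ := exists_int_gt (R + 1)
  set Q := unitCube n with hQ
  have hQm : MeasurableSet Q := by
    have : Q = Set.univ.pi fun i => Set.Ioc ((0 : Fin n → ℝ) i) ((0 : Fin n → ℝ) i + 1) := by
      ext x; simp [hQ, unitCube]
    rw [this]
    exact MeasurableSet.univ_pi fun i => measurableSet_Ioc
  have hQn : ∀ s ∈ Q, ‖s‖ ≤ 1 := by
    intro s hs
    rw [pi_norm_le_iff_of_nonneg zero_le_one]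
    intro i
    have := hs i
    simp only [Pi.zero_apply, zero_add, Set.mem_Ioc] at this
    rw [Real.norm_eq_abs, abs_le]
    exact ⟨by linarith, this.2⟩
  have hint : Integrable F := hF.integrable_of_hasCompactSupport
    (HasCompactSupport.intro (isCompact_closedBall (0 : Fin n → ℝ) R) fun s hs => by
      by_contra h
      exact hs (by simpa using hR s h))
  have h1 : ∫ s in Q, ∑ᶠ k, F (s + intVec k) = ∫ s in Q, ∑ k ∈ intBox n M, F (s + intVec k) := by
    refine setIntegral_congr_fun hQm fun s hs => ?_
    refine finsum_eq_sum_of_support_subset _ fun k hk => ?_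
    exact mem_intBox_of_norm_add_le (hR _ hk) (by linarith [hQn s hs])
  rw [h1, integral_finsetSum _ fun k _ => (hint.comp_add_right (intVec k)).integrableOn]
  have h2 : ∀ k, ∫ s in Q, F (s + intVec k) = ∫ s, (Q.indicator 1 (s - intVec k) : ℂ) * F s := by
    intro k
    rw [← integral_indicator hQm, ← integral_add_right_eq_self (μ := volume)
      (fun s => (Q.indicator 1 (s - intVec k) : ℂ) * F s) (intVec k)]
    congr 1
    funext s
    rw [add_sub_cancel_right]
    by_cases hs : s ∈ Q <;> simp [hs]
  simp_rw [h2]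
  rw [← integral_finsetSum]
  · congr 1
    funext s
    rw [← Finset.sum_mul]
    by_cases hs : F s = 0
    · rw [hs, mul_zero]
    -- The cube is a product of intervals `(0, 1]`, so the unique translate containing `s` is given
    -- by the ceiling minus one.
    set k₀ : Fin n → ℤ := fun i => ⌈s i⌉ - 1 with hk₀
    have hmem : ∀ k, s - intVec k ∈ Q ↔ k = k₀ := by
      intro k
      simp only [hQ, unitCube, Set.mem_ofPred_eq, Pi.sub_apply, Pi.zero_apply, zero_add, Set.mem_Ioc, intVec,
        hk₀, funext_iff]
      refine forall_congr' fun i => ?_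
      rw [eq_sub_iff_add_eq, eq_comm, Int.ceil_eq_iff]
      push_cast
      constructor <;> rintro ⟨h1, h2⟩ <;> constructor <;> linarith
    have hk₀' : s - intVec k₀ ∈ Q := (hmem k₀).2 rfl
    rw [Finset.sum_eq_single_of_mem k₀]
    · simp [hk₀']
    · refine mem_intBox_of_norm_le ?_
      calc ‖intVec k₀‖ = ‖s - (s - intVec k₀)‖ := by rw [sub_sub_cancel]
        _ ≤ ‖s‖ + ‖s - intVec k₀‖ := norm_sub_le _ _
        _ ≤ R + 1 := add_le_add (hR s hs) (hQn _ hk₀')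
        _ ≤ M := hM.le
    · intro k _ hk
      have : s - intVec k ∉ Q := fun h => hk ((hmem k).1 h)
      simp [this]
  · intro k _
    have hm : Measurable fun s : Fin n → ℝ => s - intVec k := measurable_id.sub_const _
    have : (fun s => (Q.indicator 1 (s - intVec k) : ℂ) * F s)
        = ((fun s => s - intVec k) ⁻¹' Q).indicator F := by
      funext s
      by_cases hs : s - intVec k ∈ Q <;> simp [Set.indicator, hs]
    rw [this]
    exact hint.indicator (hm hQm)

end Torus

/-! ### Frequency coordinates in which the dual lattice is `ℤⁿ`. -/

section Lattice

variable {n : ℕ}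

/-- The exponential `s ↦ exp (2πi ⟨m, s⟩)` on `ℝⁿ`. -/
noncomputable def torusExp (m : Fin n → ℤ) (s : Fin n → ℝ) : ℂ :=
  UnitAddTorus.mFourier m (torusMk s)

theorem continuous_torusExp (m : Fin n → ℤ) : Continuous (torusExp m) :=
  (map_continuous (UnitAddTorus.mFourier m)).comp isOpenQuotientMap_torusMk.continuous

theorem torusExp_eq (m : Fin n → ℤ) (s : Fin n → ℝ) :
    torusExp m s = Real.fourierChar (∑ j, m j * s j) := by
  simp only [torusExp, UnitAddTorus.mFourier, ContinuousMap.coe_mk, torusMk, fourier_coe_apply,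
    Real.fourierChar_apply, ← Complex.exp_sum]
  congr 1
  push_cast
  rw [Finset.mul_sum, Finset.sum_mul]
  exact Finset.sum_congr rfl fun _ _ => by simp; ring

theorem torusExp_add_intVec (m : Fin n → ℤ) (s : Fin n → ℝ) (k : Fin n → ℤ) :
    torusExp m (s + intVec k) = torusExp m s := by
  rw [torusExp, torusMk_add_intVec, torusExp]

theorem conj_torusExp_mul (m m' : Fin n → ℤ) (s : Fin n → ℝ) :
    (starRingEnd ℂ) (torusExp m s) * torusExp m' s = torusExp (m' - m) s := by
  rw [torusExp, ← UnitAddTorus.mFourier_neg, torusExp, ← UnitAddTorus.mFourier_add, torusExp]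
  congr 2
  abel

/-- Coordinates on the frequency space adapted to the lattice `Γ`. -/
theorem exists_lattice_coordinates (Γ : Submodule ℤ (RSpace n)) [DiscreteTopology Γ]
    [IsZLattice ℝ Γ] :
    ∃ (b : Module.Basis (Fin n) ℤ Γ) (τ : RSpace n ≃L[ℝ] (Fin n → ℝ)),
      ∀ ξ j, τ ξ j = inner ℝ (b j : RSpace n) ξ := by
  have : Module.Free ℤ Γ := ZLattice.module_free ℝ Γ
  have : Module.Finite ℤ Γ := ZLattice.module_finite ℝ Γ
  have hrank : Module.finrank ℤ Γ = n := by
    rw [ZLattice.rank ℝ Γ, finrank_euclideanSpace_fin]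
  let b : Module.Basis (Fin n) ℤ Γ := Module.finBasisOfFinrankEq ℤ Γ hrank
  let B := b.ofZLatticeBasis ℝ Γ
  let T : RSpace n →ₗ[ℝ] (Fin n → ℝ) := LinearMap.pi fun j => innerₗ (RSpace n) (b j : RSpace n)
  have hT : Function.Injective T := by
    rw [← LinearMap.ker_eq_bot, LinearMap.ker_eq_bot']
    intro ξ hξ
    rw [← inner_self_eq_zero (𝕜 := ℝ)]
    conv_lhs => rw [← B.sum_repr ξ, sum_inner]
    refine Finset.sum_eq_zero fun j _ => ?_
    have h := congrFun hξ j
    have hB : B j = (b j : RSpace n) := b.ofZLatticeBasis_apply ℝ Γ j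
    rw [B.sum_repr ξ, real_inner_smul_left, hB]
    simp only [T, LinearMap.pi_apply, innerₗ_apply_apply, Pi.zero_apply] at h
    rw [h, mul_zero]
  refine ⟨b, (LinearEquiv.ofInjectiveOfFinrankEq T hT (by simp)).toContinuousLinearEquiv,
    fun ξ j => rfl⟩

theorem fourierChar_neg_inner_eq_torusExp {Γ : Submodule ℤ (RSpace n)}
    (b : Module.Basis (Fin n) ℤ Γ) {τ : RSpace n → (Fin n → ℝ)}
    (hτ : ∀ ξ j, τ ξ j = inner ℝ (b j : RSpace n) ξ) (γ : Γ) (ξ : RSpace n) :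
    (Real.fourierChar (-inner ℝ (γ : RSpace n) ξ) : ℂ) = torusExp (-⇑(b.repr γ)) (τ ξ) := by
  rw [torusExp_eq]
  congr 3
  have h1 : (γ : RSpace n) = ∑ j, (b.repr γ j) • (b j : RSpace n) := by
    have := congrArg Subtype.val (b.sum_repr γ)
    rw [Submodule.coe_sum] at this
    exact this.symm
  conv_lhs => rw [h1, sum_inner]
  rw [← Finset.sum_neg_distrib]
  refine Finset.sum_congr rfl fun j _ => ?_
  rw [← Int.cast_smul_eq_zsmul ℝ, real_inner_smul_left, hτ]
  simp

end Lattice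

/-! ### From smooth frames to orthonormal translates and their closed span. -/

/-- Smooth functions on `ℝⁿ` supported in a ball for the seminorm `ν`, whose values along the
cosets of `ℤⁿ` are orthonormal and which reproduce every function supported in a smaller ball. -/
structure IsSmoothFrame {n N : ℕ} (ν : Seminorm ℝ (Fin n → ℝ)) (r₁ r₃ : ℝ)
    (g : Fin N → (Fin n → ℝ) → ℝ) : Prop where
  contDiff : ∀ i, ContDiff ℝ ∞ (g i)
  eq_zero : ∀ i s, r₃ ≤ ν s → g i s = 0
  orthonormal : ∀ i j s,
    seqPairing (cosetValues (g i) s) (cosetValues (g j) s) = if i = j then 1 else 0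
  reproducing : ∀ s, ν s ≤ r₁ → ∀ k, ∑ i, g i s * g i (s + intVec k) = if k = 0 then 1 else 0

namespace IsSmoothFrame

variable {n N : ℕ} {ν : Seminorm ℝ (Fin n → ℝ)} {r₁ r₃ : ℝ} {g : Fin N → (Fin n → ℝ) → ℝ}

theorem norm_le (hg : IsSmoothFrame ν r₁ r₃ g) (hν : ∀ x, ‖x‖ ≤ ν x) (i : Fin N)
    (s : Fin n → ℝ) (hs : g i s ≠ 0) : ‖s‖ ≤ r₃ :=
  (hν s).trans (le_of_not_ge fun h => hs (hg.eq_zero i s h))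

/-- Unfolding over the unit cube turns the product of frame functions into their coset pairing, a
constant; orthogonality of characters on the torus does the rest. -/
theorem integral_torusExp_mul (hg : IsSmoothFrame ν r₁ r₃ g) (hν : ∀ x, ‖x‖ ≤ ν x)
    (m : Fin n → ℤ) (i j : Fin N) :
    ∫ s, torusExp m s * ((g i s * g j s : ℝ) : ℂ) = if m = 0 ∧ i = j then 1 else 0 := by
  rw [integral_eq_setIntegral_unitCube (R := r₃)]
  · have : ∀ s, ∑ᶠ k, torusExp m (s + intVec k) *
        ((g i (s + intVec k) * g j (s + intVec k) : ℝ) : ℂ)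
        = torusExp m s * (if i = j then 1 else 0) := by
      intro s
      simp_rw [torusExp_add_intVec]
      obtain ⟨M, hM⟩ := exists_int_gt (r₃ + ‖s‖)
      have hΦ := mem_intBox_of_apply_ne_zero (hg.norm_le hν i) hM.le
      have h1 := hg.orthonormal i j s
      rw [seqPairing_eq_sum hΦ] at h1
      rw [finsum_eq_sum_of_support_subset (s := intBox n M), ← Finset.mul_sum]
      · congr 1
        have h2 := congrArg (fun x : ℝ => (x : ℂ)) h1
        simp only [cosetValues] at h2
        rw [← Complex.ofReal_sum, h2]
        split_ifs <;> simp
      · intro k hk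
        refine hΦ k fun h => hk ?_
        simp only [cosetValues] at h
        simp [h]
    simp_rw [this]
    rw [integral_mul_const]
    unfold torusExp
    rw [setIntegral_unitCube_mFourier]
    split_ifs <;> simp_all
  · exact (continuous_torusExp m).mul (Complex.continuous_ofReal.comp
      ((hg.contDiff i).continuous.mul (hg.contDiff j).continuous))
  · intro s hs
    refine hg.norm_le hν i s fun h => hs ?_
    simp [h]

/-- The Schwartz function on the frequency space attached to an element of a smooth frame. -/
theorem exists_schwartzMap (hg : IsSmoothFrame ν r₁ r₃ g) (hν : ∀ x, ‖x‖ ≤ ν x) (κ : ℝ)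
    (τ : RSpace n ≃L[ℝ] (Fin n → ℝ)) (i : Fin N) :
    ∃ φ : 𝓢(RSpace n, ℂ), (∀ ξ, 𝓕 φ ξ = ((κ * g i (τ ξ) : ℝ) : ℂ)) ∧
      HasCompactSupport ⇑(𝓕 φ : 𝓢(RSpace n, ℂ)) := by
  have hcs : HasCompactSupport fun ξ : RSpace n => ((κ * g i (τ ξ) : ℝ) : ℂ) := by
    refine HasCompactSupport.intro
      (K := τ.toHomeomorph ⁻¹' Metric.closedBall (0 : Fin n → ℝ) r₃) ?_ fun ξ hξ => ?_
    · exact τ.toHomeomorph.isCompact_preimage.2 (isCompact_closedBall _ _)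
    · have : g i (τ ξ) = 0 := by
        by_contra h
        exact hξ (by simpa using hg.norm_le hν i _ h)
      simp [this]
  have hsm : ContDiff ℝ ∞ fun ξ : RSpace n => ((κ * g i (τ ξ) : ℝ) : ℂ) :=
    Complex.ofRealCLM.contDiff.comp (contDiff_const.mul ((hg.contDiff i).comp τ.contDiff))
  refine ⟨𝓕⁻ (hcs.toSchwartzMap hsm), ?_⟩
  rw [FourierTransform.fourier_fourierInv_eq]
  exact ⟨fun ξ => rfl, hcs⟩

end IsSmoothFrame

section FourierSupport

variable {n : ℕ}

/-- The closed subspace of functions in `L²` whose Fourier transform vanishes on `S`. -/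
noncomputable def fourierZeroOn (S : Set (RSpace n)) : Submodule ℂ (L2Space n) :=
  LinearMap.ker ((LpToLpRestrictCLM (RSpace n) ℂ ℂ volume 2 S).comp
    (Lp.fourierTransformₗᵢ (RSpace n) ℂ).toContinuousLinearEquiv.toContinuousLinearMap).toLinearMap

theorem isClosed_fourierZeroOn (S : Set (RSpace n)) :
    IsClosed (fourierZeroOn S : Set (L2Space n)) :=
  ContinuousLinearMap.isClosed_ker _

theorem mem_fourierZeroOn {S : Set (RSpace n)} (hS : MeasurableSet S) {f : L2Space n} :
    f ∈ fourierZeroOn S ↔ ∀ᵐ ξ, ξ ∈ S → (𝓕 f : L2Space n) ξ = 0 := by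
  have h1 : f ∈ fourierZeroOn S ↔ LpToLpRestrictCLM (RSpace n) ℂ ℂ volume 2 S (𝓕 f) = 0 :=
    Iff.rfl
  have h2 := LpToLpRestrictCLM_coeFn ℂ S (𝓕 f : L2Space n)
  rw [h1, Lp.eq_zero_iff_ae_eq_zero, ← ae_restrict_iff' hS]
  constructor
  · intro h
    filter_upwards [h, h2] with x hx hx2
    rw [← hx2, hx]
    rfl
  · intro h
    filter_upwards [h, h2] with x hx hx2
    rw [hx2, hx]
    rfl

end FourierSupport

section PullbackMul

variable {n : ℕ} {T : Type*} [TopologicalSpace T] [CompactSpace T] {u : RSpace n → T}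

theorem memLp_comp_mul (hu : Continuous u) (F : L2Space n) (p : C(T, ℂ)) :
    MemLp (fun ξ => p (u ξ) * F ξ) 2 (volume : Measure (RSpace n)) := by
  refine MemLp.of_le_mul (Lp.memLp F) (c := ‖p‖) (((map_continuous p).comp hu).aestronglyMeasurable.mul
    (Lp.aestronglyMeasurable F)) (Filter.Eventually.of_forall fun ξ => ?_)
  rw [norm_mul]
  exact mul_le_mul_of_nonneg_right (p.norm_coe_le_norm _) (norm_nonneg _)

/-- Multiplication of a fixed `L²` function by pullbacks of continuous functions. -/
noncomputable def pullbackMul (hu : Continuous u) (F : L2Space n) : C(T, ℂ) →L[ℂ] L2Space n :=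
  LinearMap.mkContinuous
    { toFun := fun p => (memLp_comp_mul hu F p).toLp _
      map_add' := fun p q => by
        rw [← MemLp.toLp_add]
        refine MemLp.toLp_congr _ _ (Filter.Eventually.of_forall fun ξ => ?_)
        simp [add_mul]
      map_smul' := fun c p => by
        rw [RingHom.id_apply, ← MemLp.toLp_const_smul]
        refine MemLp.toLp_congr _ _ (Filter.Eventually.of_forall fun ξ => ?_)
        simp [mul_assoc] } ‖F‖ (fun p => by
      rw [mul_comm]
      refine Lp.norm_le_mul_norm_of_ae_le_mul ?_
      simp only [LinearMap.coe_mk, AddHom.coe_mk]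
      filter_upwards [(memLp_comp_mul hu F p).coeFn_toLp] with ξ hξ
      rw [hξ, norm_mul]
      exact mul_le_mul_of_nonneg_right (p.norm_coe_le_norm _) (norm_nonneg _))

theorem coeFn_pullbackMul (hu : Continuous u) (F : L2Space n) (p : C(T, ℂ)) :
    pullbackMul hu F p =ᵐ[volume] fun ξ => p (u ξ) * F ξ :=
  (memLp_comp_mul hu F p).coeFn_toLp

end PullbackMul

namespace IsSmoothFrame

variable {n N : ℕ} {ν : Seminorm ℝ (Fin n → ℝ)} {r₁ r₃ : ℝ} {g : Fin N → (Fin n → ℝ) → ℝ}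
  {Γ : Submodule ℤ (RSpace n)} {b : Module.Basis (Fin n) ℤ Γ} {τ : RSpace n ≃L[ℝ] (Fin n → ℝ)}
  {κ : ℝ} {φ : Fin N → 𝓢(RSpace n, ℂ)}

theorem coeFn_fourier_translates (hτ : ∀ ξ j, τ ξ j = inner ℝ (b j : RSpace n) ξ)
    (hφ : ∀ i ξ, 𝓕 (φ i) ξ = ((κ * g i (τ ξ) : ℝ) : ℂ)) (p : Γ × Fin N) :
    (𝓕 (translates Γ (fun i => (φ i).toLp 2 volume) p) : L2Space n) =ᵐ[volume]
      fun ξ => torusExp (-⇑(b.repr p.1)) (τ ξ) * ((κ * g p.2 (τ ξ) : ℝ) : ℂ) := by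
  filter_upwards [coeFn_fourier_translateL2 (p.1 : RSpace n) (φ p.2)] with ξ hξ
  rw [translates, hξ, hφ, fourierChar_neg_inner_eq_torusExp b hτ]

theorem orthonormal_translates (hg : IsSmoothFrame ν r₁ r₃ g) (hν : ∀ x, ‖x‖ ≤ ν x)
    (hτ : ∀ ξ j, τ ξ j = inner ℝ (b j : RSpace n) ξ) {c : ℝ≥0∞}
    (hc : (volume : Measure (RSpace n)).map τ = c • (volume : Measure (Fin n → ℝ)))
    (hκ : κ ^ 2 * c.toReal = 1) (hφ : ∀ i ξ, 𝓕 (φ i) ξ = ((κ * g i (τ ξ) : ℝ) : ℂ)) :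
    Orthonormal ℂ (translates Γ (fun i => (φ i).toLp 2 volume)) := by
  classical
  rw [orthonormal_iff_ite]
  intro p q
  rw [← Lp.inner_fourier_eq, L2.inner_def]
  set m : Fin n → ℤ := -⇑(b.repr q.1) - -⇑(b.repr p.1) with hm
  set G : (Fin n → ℝ) → ℂ := fun s => torusExp m s * ((g p.2 s * g q.2 s : ℝ) : ℂ) with hG
  have h1 : ∫ ξ, inner ℂ ((𝓕 (translates Γ (fun i => (φ i).toLp 2 volume) p) : L2Space n) ξ)
      ((𝓕 (translates Γ (fun i => (φ i).toLp 2 volume) q) : L2Space n) ξ)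
      = ∫ ξ : RSpace n, ((κ ^ 2 : ℝ) : ℂ) * G (τ ξ) := by
    refine integral_congr_ae ?_
    filter_upwards [coeFn_fourier_translates hτ hφ p, coeFn_fourier_translates hτ hφ q]
      with ξ h1 h2
    rw [h1, h2, hG]
    simp only [hm]
    rw [← conj_torusExp_mul]
    simp only [RCLike.inner_apply, map_mul, Complex.conj_ofReal]
    push_cast
    ring
  have h2 := τ.toHomeomorph.measurableEmbedding.integral_map (μ := (volume : Measure (RSpace n))) G
  simp only [ContinuousLinearEquiv.coe_toHomeomorph] at h2
  rw [h1, integral_const_mul, ← h2, hc, integral_smul_measure, hG,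
    hg.integral_torusExp_mul hν m p.2 q.2, Complex.real_smul, ← mul_assoc, ← Complex.ofReal_mul,
    hκ, Complex.ofReal_one, one_mul]
  refine if_congr ?_ rfl rfl
  have h3 : m = 0 ↔ p.1 = q.1 := by
    rw [hm, sub_eq_zero, neg_inj, DFunLike.coe_fn_eq, b.repr.injective.eq_iff, eq_comm]
  rw [h3, Prod.ext_iff]

/-- The closed span of the translates consists of functions with Fourier transform supported in
the larger ball. -/
theorem closure_span_translates_le (hg : IsSmoothFrame ν r₁ r₃ g) (hνc : Continuous ν)
    (hτ : ∀ ξ j, τ ξ j = inner ℝ (b j : RSpace n) ξ)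
    (hφ : ∀ i ξ, 𝓕 (φ i) ξ = ((κ * g i (τ ξ) : ℝ) : ℂ)) :
    (Submodule.span ℂ (Set.range (translates Γ (fun i => (φ i).toLp 2 volume)))).topologicalClosure
      ≤ fourierZeroOn {ξ | r₃ ≤ ν (τ ξ)} := by
  refine Submodule.topologicalClosure_minimal _ ?_ (isClosed_fourierZeroOn _)
  rw [Submodule.span_le]
  rintro _ ⟨p, rfl⟩
  have hS : IsClosed {ξ : RSpace n | r₃ ≤ ν (τ ξ)} :=
    isClosed_le continuous_const (hνc.comp τ.continuous)
  rw [SetLike.mem_coe, mem_fourierZeroOn hS.measurableSet]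
  filter_upwards [coeFn_fourier_translates hτ hφ p] with ξ hξ hξS
  rw [hξ, hg.eq_zero _ _ hξS]
  simp

/-- For a character `p` this is a single translate; trigonometric polynomials are dense in the
continuous functions on the torus, and the map `p ↦ 𝓕⁻ (p F)` is continuous. -/
theorem pullbackMul_mem (hτ : ∀ ξ j, τ ξ j = inner ℝ (b j : RSpace n) ξ)
    (hφ : ∀ i ξ, 𝓕 (φ i) ξ = ((κ * g i (τ ξ) : ℝ) : ℂ))
    (hu : Continuous fun ξ : RSpace n => torusMk (τ ξ))
    (p : C(UnitAddTorus (Fin n), ℂ)) (i : Fin N) :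
    𝓕⁻ (pullbackMul hu ((𝓕 (φ i)).toLp 2 volume) p) ∈
      (Submodule.span ℂ
        (Set.range (translates Γ (fun i => (φ i).toLp 2 volume)))).topologicalClosure := by
  set V := (Submodule.span ℂ
    (Set.range (translates Γ (fun i => (φ i).toLp 2 volume)))).topologicalClosure with hV
  let L : C(UnitAddTorus (Fin n), ℂ) →L[ℂ] L2Space n :=
    (Lp.fourierTransformₗᵢ (RSpace n) ℂ).symm.toContinuousLinearEquiv.toContinuousLinearMap.comp
      (pullbackMul hu ((𝓕 (φ i)).toLp 2 volume))
  have hle : (Submodule.span ℂ (Set.range UnitAddTorus.mFourier)).topologicalClosure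
      ≤ V.comap L.toLinearMap := by
    refine Submodule.topologicalClosure_minimal _ ?_
      ((Submodule.isClosed_topologicalClosure _).preimage L.continuous)
    rw [Submodule.span_le]
    rintro _ ⟨m, rfl⟩
    -- Translation by `γ` modulates by the character of index `-b.repr γ`, hence the sign.
    have hγ : ⇑(b.repr (b.equivFun.symm (-m))) = -m := by
      rw [← b.equivFun_apply, LinearEquiv.apply_symm_apply]
    have : L (UnitAddTorus.mFourier m)
        = translates Γ (fun i => (φ i).toLp 2 volume) (b.equivFun.symm (-m), i) := by
      refine (LinearIsometryEquiv.symm_apply_eq _).2 (Lp.ext ?_)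
      filter_upwards [coeFn_pullbackMul hu ((𝓕 (φ i)).toLp 2 volume) (UnitAddTorus.mFourier m),
        coeFn_fourier_translates hτ hφ (b.equivFun.symm (-m), i),
        (𝓕 (φ i)).coeFn_toLp 2 volume] with ξ h1 h2 h3
      refine h1.trans (Eq.trans ?_ h2.symm)
      rw [h3, hφ]
      simp only [hγ, neg_neg, torusExp]
    change L (UnitAddTorus.mFourier m) ∈ V
    rw [this]
    exact Submodule.le_topologicalClosure _ (Submodule.subset_span ⟨_, rfl⟩)
  rw [UnitAddTorus.span_mFourier_closure_eq_top] at hle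
  exact hle (Submodule.mem_top (x := p))

/-- A test function supported in the smaller ball is a combination of the elements of the frame
with continuous periodic coefficients. -/
theorem exists_periodic_coefficients (hg : IsSmoothFrame ν r₁ r₃ g) {h : (Fin n → ℝ) → ℝ}
    (hν : ∀ x, ‖x‖ ≤ ν x) (hh : ContDiff ℝ ∞ h) (hsupp : ∀ s, h s ≠ 0 → ν s ≤ r₁) :
    ∃ c : Fin N → C(UnitAddTorus (Fin n), ℂ),
      ∀ s, ∑ i, c i (torusMk s) * (g i s : ℂ) = (h s : ℂ) := by
  have hR : ∀ s, h s ≠ 0 → ‖s‖ ≤ r₁ := fun s hs => (hν s).trans (hsupp s hs)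
  have hcont : ∀ i, Continuous fun s => ((seqPairing (cosetValues h s) (cosetValues (g i) s) : ℝ) : ℂ) :=
    fun i => Complex.continuous_ofReal.comp
      (contDiff_seqPairing_cosetValues hR hh (hg.contDiff i)).continuous
  have hlift : ∀ i, ∃ c : C(UnitAddTorus (Fin n), ℂ), ∀ s,
      c (torusMk s) = ((seqPairing (cosetValues h s) (cosetValues (g i) s) : ℝ) : ℂ) := by
    intro i
    let q : C(Fin n → ℝ, UnitAddTorus (Fin n)) := ⟨torusMk, isOpenQuotientMap_torusMk.continuous⟩
    have hq : Topology.IsQuotientMap q := isOpenQuotientMap_torusMk.isQuotientMap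
    have hper : Function.FactorsThrough (⟨_, hcont i⟩ : C(Fin n → ℝ, ℂ)) q := by
      intro s s' hs
      obtain ⟨k, rfl⟩ := exists_eq_add_intVec_of_torusMk_eq hs
      simp only [ContinuousMap.coe_mk]
      rw [seqPairing_cosetValues_periodic]
    exact ⟨hq.lift _ hper, fun s => DFunLike.congr_fun (hq.lift_comp _ hper) s⟩
  choose c hl using hlift
  refine ⟨c, fun s => ?_⟩
  · simp only [hl]
    obtain ⟨M, hM⟩ := exists_int_gt (r₁ + ‖s‖)
    -- Only points `s + k` of the small ball contribute, and there the reproducing identity, applied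
    -- at `s + k` with shift `-k`, leaves just the term `k = 0`.
    have key : ∑ i, seqPairing (cosetValues h s) (cosetValues (g i) s) * g i s = h s := by
      simp_rw [seqPairing_eq_sum (mem_intBox_of_apply_ne_zero hR hM.le), Finset.sum_mul]
      rw [Finset.sum_comm]
      have h1 : ∀ k, ∑ i, cosetValues h s k * cosetValues (g i) s k * g i s
          = if k = 0 then h s else 0 := by
        intro k
        by_cases hk : h (s + intVec k) = 0
        · simp only [cosetValues, hk, zero_mul, Finset.sum_const_zero]
          split_ifs with h0
          · subst h0; simpa using hk.symm
          · rfl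
        · have := hg.reproducing _ (hsupp _ hk) (-k)
          rw [intVec_neg, add_neg_cancel_right] at this
          simp only [cosetValues, mul_assoc, ← Finset.mul_sum, this, neg_eq_zero]
          split_ifs with h0
          · subst h0; simp
          · simp
      simp_rw [h1]
      by_cases h0 : h s = 0
      · simp [h0]
      · rw [Finset.sum_ite_eq', if_pos]
        refine mem_intBox_of_norm_le ?_
        have := hR s h0
        simp only [intVec_zero, norm_zero]
        linarith [norm_nonneg s]
    exact_mod_cast congrArg (fun x : ℝ => (x : ℂ)) key

/-- Test functions supported in the smaller ball are Fourier transforms of elements of the closed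
span of the translates. -/
theorem exists_mem_closure_span_translates (hg : IsSmoothFrame ν r₁ r₃ g) (hν : ∀ x, ‖x‖ ≤ ν x)
    (hτ : ∀ ξ j, τ ξ j = inner ℝ (b j : RSpace n) ξ) (hκ : κ ≠ 0)
    (hφ : ∀ i ξ, 𝓕 (φ i) ξ = ((κ * g i (τ ξ) : ℝ) : ℂ)) {h : RSpace n → ℝ} (hh : ContDiff ℝ ∞ h)
    (hsupp : ∀ ξ, h ξ ≠ 0 → ν (τ ξ) ≤ r₁) :
    ∃ H ∈ (Submodule.span ℂ
      (Set.range (translates Γ (fun i => (φ i).toLp 2 volume)))).topologicalClosure,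
      (𝓕 H : L2Space n) =ᵐ[volume] fun ξ => (h ξ : ℂ) := by
  have hu : Continuous fun ξ : RSpace n => torusMk (τ ξ) :=
    isOpenQuotientMap_torusMk.continuous.comp τ.continuous
  obtain ⟨c, hc⟩ := hg.exists_periodic_coefficients (h := h ∘ τ.symm) hν
    (hh.comp τ.symm.contDiff) (by
      intro s hs
      simpa using hsupp _ hs)
  obtain ⟨P, hP⟩ : ∃ P : Fin N → L2Space n,
      ∀ i, P i = pullbackMul hu ((𝓕 (φ i)).toLp 2 volume) (c i) := ⟨_, fun _ => rfl⟩
  have hmem := fun i => pullbackMul_mem hτ hφ hu (c i) i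
  simp only [← hP] at hmem
  have h1 : ∀ i, ∀ᵐ ξ : RSpace n, P i ξ = (κ : ℂ) * (c i (torusMk (τ ξ)) * (g i (τ ξ) : ℂ)) := by
    intro i
    rw [hP]
    filter_upwards [coeFn_pullbackMul hu ((𝓕 (φ i)).toLp 2 volume) (c i),
      (𝓕 (φ i)).coeFn_toLp 2 volume] with ξ h2 h3
    rw [h2, h3, hφ]
    push_cast
    ring
  set Φ := Lp.fourierTransformₗᵢ (RSpace n) ℂ
  refine ⟨(κ⁻¹ : ℂ) • ∑ i, Φ.symm (P i),
    Submodule.smul_mem _ _ (Submodule.sum_mem _ fun i _ => hmem i), ?_⟩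
  have hsum : Φ ((κ⁻¹ : ℂ) • ∑ i, Φ.symm (P i)) = (κ⁻¹ : ℂ) • ∑ i, P i := by
    rw [map_smul, map_sum]
    simp only [LinearIsometryEquiv.apply_symm_apply]
  change (Φ ((κ⁻¹ : ℂ) • ∑ i, Φ.symm (P i)) : L2Space n) =ᵐ[volume] _
  rw [hsum]
  filter_upwards [Lp.coeFn_smul (κ⁻¹ : ℂ) (∑ i, P i), Lp.coeFn_finsetSum Finset.univ P,
    ae_all_iff.2 h1] with ξ h2 h3 h4
  rw [h2, Pi.smul_apply, h3, Finset.sum_apply]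
  simp_rw [h4]
  rw [← Finset.mul_sum, hc (τ ξ), smul_eq_mul]
  have : (κ : ℂ) ≠ 0 := by exact_mod_cast hκ
  simp [this]

/-- Every function with Fourier transform supported in the smaller ball belongs to the closed span
of the translates. -/
theorem fourierZeroOn_le_closure_span_translates (hg : IsSmoothFrame ν r₁ r₃ g)
    (hν : ∀ x, ‖x‖ ≤ ν x) (hνc : Continuous ν)
    (hτ : ∀ ξ j, τ ξ j = inner ℝ (b j : RSpace n) ξ) (hκ : κ ≠ 0)
    (hφ : ∀ i ξ, 𝓕 (φ i) ξ = ((κ * g i (τ ξ) : ℝ) : ℂ)) :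
    fourierZeroOn {ξ | r₁ ≤ ν (τ ξ)} ≤ (Submodule.span ℂ
      (Set.range (translates Γ (fun i => (φ i).toLp 2 volume)))).topologicalClosure := by
  set V := (Submodule.span ℂ
    (Set.range (translates Γ (fun i => (φ i).toLp 2 volume)))).topologicalClosure with hV
  have hντ : Continuous fun ξ : RSpace n => ν (τ ξ) := hνc.comp τ.continuous
  set U : Set (RSpace n) := {ξ | ν (τ ξ) < r₁} with hU
  have hUo : IsOpen U := isOpen_lt hντ continuous_const
  have hVV : Vᗮᗮ = V := by
    rw [Submodule.orthogonal_orthogonal_eq_closure]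
    exact (Submodule.isClosed_topologicalClosure _).submodule_topologicalClosure_eq
  -- The transform of `w` annihilates all test functions supported in `U`, so it vanishes there;
  -- band-limited functions are thus orthogonal to `Vᗮ`.
  have horth : ∀ w ∈ Vᗮ, ∀ᵐ ξ : RSpace n, ξ ∈ U → (𝓕 w : L2Space n) ξ = 0 := by
    intro w hw
    refine hUo.ae_eq_zero_of_integral_contDiff_smul_eq_zero
      (((Lp.memLp (𝓕 w : L2Space n)).locallyIntegrable one_le_two).locallyIntegrableOn _) ?_
    intro h hh hhc hhU
    obtain ⟨H, hHV, hH⟩ := hg.exists_mem_closure_span_translates hν hτ hκ hφ hh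
      fun ξ hξ => (hhU (subset_tsupport _ hξ)).le
    have h1 : inner ℂ H w = 0 := hw H hHV
    rw [← Lp.inner_fourier_eq, L2.inner_def] at h1
    rw [← h1]
    refine integral_congr_ae ?_
    filter_upwards [hH] with ξ hξ
    rw [hξ]
    simp [mul_comm]
  intro f hf
  rw [mem_fourierZeroOn (isClosed_le continuous_const hντ).measurableSet] at hf
  rw [← hVV]
  intro w hw
  rw [← Lp.inner_fourier_eq, L2.inner_def]
  refine integral_eq_zero_of_ae ?_
  filter_upwards [hf, horth w hw] with ξ h1 h2
  by_cases hξ : r₁ ≤ ν (τ ξ)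
  · rw [h1 hξ]; simp
  · rw [h2 (not_le.1 hξ)]; simp

end IsSmoothFrame

/-! ### Matrix dilations and their action on frequency supports. -/

section MatrixDilation

variable {n : ℕ}

/-- The linear equivalence of Euclidean space given by an invertible matrix. -/
noncomputable def matrixEquiv (M M' : Matrix (Fin n) (Fin n) ℝ) (h : M * M' = 1) :
    RSpace n ≃L[ℝ] RSpace n :=
  (LinearEquiv.ofLinearMap (Matrix.toEuclideanLin M) (Matrix.toEuclideanLin M')
    (by ext1 x; simp [Matrix.toLpLin_apply, h])
    (by ext1 x; simp [Matrix.toLpLin_apply, mul_eq_one_comm.1 h])).toContinuousLinearEquiv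

theorem zpow_mul_zpow_neg_self {A : Matrix (Fin n) (Fin n) ℝ} (hA : IsUnit A.det) (j : ℤ) :
    A ^ j * A ^ (-j) = 1 := by
  rw [← Matrix.zpow_add hA, add_neg_cancel, zpow_zero]

/-- The dilation `x ↦ A ^ j x`. -/
noncomputable def dil {A : Matrix (Fin n) (Fin n) ℝ} (hA : IsUnit A.det) (j : ℤ) :
    RSpace n ≃L[ℝ] RSpace n :=
  matrixEquiv (A ^ j) (A ^ (-j)) (zpow_mul_zpow_neg_self hA j)

/-- The contragredient dilation on the frequency space. -/
noncomputable def codil {A : Matrix (Fin n) (Fin n) ℝ} (hA : IsUnit A.det) (j : ℤ) :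
    RSpace n ≃L[ℝ] RSpace n :=
  matrixEquiv (A ^ (-j)).transpose (A ^ j).transpose (by
    rw [← Matrix.transpose_mul, zpow_mul_zpow_neg_self hA j, Matrix.transpose_one])

variable {A : Matrix (Fin n) (Fin n) ℝ} (hA : IsUnit A.det)

theorem dil_apply (j : ℤ) (x : RSpace n) : dil hA j x = Matrix.toEuclideanLin (A ^ j) x := rfl

theorem codil_apply (j : ℤ) (x : RSpace n) :
    codil hA j x = Matrix.toEuclideanLin (A ^ (-j)).transpose x := rfl

theorem toEuclideanLin_mul_apply (M M' : Matrix (Fin n) (Fin n) ℝ) (x : RSpace n) :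
    Matrix.toEuclideanLin (M * M') x = Matrix.toEuclideanLin M (Matrix.toEuclideanLin M' x) := by
  simp [Matrix.toLpLin_apply]

theorem dil_add (j k : ℤ) (x : RSpace n) : dil hA (j + k) x = dil hA j (dil hA k x) := by
  simp only [dil_apply]
  rw [Matrix.zpow_add hA, toEuclideanLin_mul_apply]

theorem dil_zero (x : RSpace n) : dil hA 0 x = x := by
  simp [dil_apply]

theorem codil_add (j k : ℤ) (x : RSpace n) : codil hA (j + k) x = codil hA j (codil hA k x) := by
  simp only [codil_apply]
  rw [show -(j + k) = -k + -j by ring, Matrix.zpow_add hA, Matrix.transpose_mul,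
    toEuclideanLin_mul_apply]

theorem codil_zero (x : RSpace n) : codil hA 0 x = x := by
  simp [codil_apply]

theorem inner_dil_codil (j : ℤ) (x ξ : RSpace n) :
    inner ℝ (dil hA j x) (codil hA j ξ) = inner ℝ x ξ := by
  have h1 : ∀ (M : Matrix (Fin n) (Fin n) ℝ) (x y : RSpace n),
      inner ℝ (Matrix.toEuclideanLin M x) y = inner ℝ x (Matrix.toEuclideanLin M.transpose y) := by
    intro M x y
    rw [← Matrix.conjTranspose_eq_transpose_of_trivial,
      Matrix.toEuclideanLin_conjTranspose_eq_adjoint, LinearMap.adjoint_inner_right]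
  rw [dil_apply, h1, codil_apply, ← toEuclideanLin_mul_apply, ← Matrix.transpose_mul,
    ← Matrix.zpow_add hA, neg_add_cancel, zpow_zero, Matrix.transpose_one]
  simp

theorem compL2_dil_add (j k : ℤ) (f : L2Space n) :
    compL2 (dil hA j) (compL2 (dil hA k) f) = compL2 (dil hA (k + j)) f := by
  refine Lp.ext ?_
  filter_upwards [coeFn_compL2 (dil hA j) (compL2 (dil hA k) f),
    (dil hA j).quasiMeasurePreserving.ae_eq_comp (coeFn_compL2 (dil hA k) f),
    coeFn_compL2 (dil hA (k + j)) f] with x h1 h2 h3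
  rw [h1, h2, h3]
  simp only [Function.comp_apply, dil_add]

theorem compL2_dil_zero (f : L2Space n) : compL2 (dil hA 0) f = f := by
  refine Lp.ext ?_
  filter_upwards [coeFn_compL2 (dil hA 0) f] with x h1
  rw [h1, Function.comp_apply, dil_zero]

theorem compL2_dil_neg (j : ℤ) (f : L2Space n) :
    compL2 (dil hA j) (compL2 (dil hA (-j)) f) = f := by
  rw [compL2_dil_add, neg_add_cancel, compL2_dil_zero]

/-- Up to a constant factor, dilating `f` composes its transform with the contragredient dilation.
-/
theorem compL2_dil_mem_fourierZeroOn {S : Set (RSpace n)} (hS : MeasurableSet S) {f : L2Space n}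
    (hf : f ∈ fourierZeroOn S) (j : ℤ) :
    compL2 (dil hA j) f ∈ fourierZeroOn (codil hA j ⁻¹' S) := by
  obtain ⟨c, hc⟩ := exists_fourier_compL2 (dil hA j) (codil hA j) (inner_dil_codil hA j)
  rw [mem_fourierZeroOn ((codil hA j).continuous.measurable hS), hc]
  rw [mem_fourierZeroOn hS] at hf
  filter_upwards [Lp.coeFn_smul (c : ℂ) (compL2 (codil hA j) (𝓕 f)),
    coeFn_compL2 (codil hA j) (𝓕 f), (codil hA j).quasiMeasurePreserving.ae hf] with ξ h1 h2 h3 h4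
  rw [h1, Pi.smul_apply, h2, Function.comp_apply, h3 h4, smul_zero]

theorem fourierZeroOn_mono {S S' : Set (RSpace n)} (hS : MeasurableSet S) (hS' : MeasurableSet S')
    (h : S' ⊆ S) : fourierZeroOn S ≤ fourierZeroOn S' := by
  intro f hf
  rw [mem_fourierZeroOn hS] at hf
  rw [mem_fourierZeroOn hS']
  filter_upwards [hf] with ξ hξ hξ'
  exact hξ (h hξ')

theorem exists_adapted_seminorm_of_isExpansive (hn : 1 ≤ n) (hexp : IsExpansive A)
    (τ : RSpace n ≃L[ℝ] (Fin n → ℝ)) :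
    ∃ l : ℝ, 1 < l ∧ ∃ ν : Seminorm ℝ (Fin n → ℝ), Continuous ν ∧ (∀ x, ‖x‖ ≤ ν x) ∧
      ∀ (p : ℕ) ξ, l ^ p * ν (τ ξ) ≤ ν (τ (codil hA (-p) ξ)) := by
  -- `Ψ` is the transpose conjugated by `τ`. It reverses products but respects powers, and it is
  -- continuous by finite dimension, so `Ψ A⁻¹ ^ m` tends to `0` with `A⁻¹ ^ m`.
  let Ψ : Matrix (Fin n) (Fin n) ℝ →ₗ[ℝ] ((Fin n → ℝ) →L[ℝ] (Fin n → ℝ)) :=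
    { toFun := fun C => (τ : RSpace n →L[ℝ] (Fin n → ℝ)).comp
        ((LinearMap.toContinuousLinearMap (Matrix.toEuclideanLin C.transpose)).comp
          (τ.symm : (Fin n → ℝ) →L[ℝ] RSpace n))
      map_add' := fun C C' => by
        ext x
        simp
      map_smul' := fun c C => by
        ext x
        simp }
  have hΨ : ∀ C x, Ψ C x = τ (Matrix.toEuclideanLin C.transpose (τ.symm x)) := fun _ _ => rfl
  have hpow : ∀ (C : Matrix (Fin n) (Fin n) ℝ) (m : ℕ), Ψ (C ^ m) = Ψ C ^ m := by
    intro C m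
    induction m with
    | zero =>
      ext1 x
      rw [hΨ]
      simp
    | succ m ih =>
      rw [pow_succ' (Ψ C), ← ih]
      ext1 x
      rw [mul_apply_eq_comp, hΨ, hΨ, hΨ, pow_succ, Matrix.transpose_mul,
        toEuclideanLin_mul_apply, ContinuousLinearEquiv.symm_apply_apply]
  have hlim : Filter.Tendsto (fun m => Ψ (A⁻¹ ^ m)) Filter.atTop (nhds 0) := by
    have := (LinearMap.continuous_of_finiteDimensional Ψ).tendsto 0
    rw [map_zero] at this
    exact this.comp (hexp.tendsto_inv_pow hn)
  obtain ⟨m, hm1, hm2⟩ := ((Filter.eventually_ge_atTop 1).and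
    (hlim.eventually (Metric.ball_mem_nhds 0 (by norm_num : (0 : ℝ) < 1 / 2)))).exists
  obtain ⟨l, hl, ν, hνc, hν, hνD⟩ := exists_adapted_seminorm (Ψ A⁻¹) hm1 (by
    intro x
    rw [← hpow]
    rw [dist_zero_right] at hm2
    have := (Ψ (A⁻¹ ^ m)).le_of_opNorm_le hm2.le x
    linarith)
  refine ⟨l, hl, ν, hνc, hν, fun p => ?_⟩
  have hD : ∀ ξ, Ψ A⁻¹ (τ ξ) = τ (codil hA 1 ξ) := by
    intro ξ
    rw [hΨ, ContinuousLinearEquiv.symm_apply_apply, codil_apply, Matrix.zpow_neg_one]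
  have hstep : ∀ ξ, l * ν (τ ξ) ≤ ν (τ (codil hA (-1) ξ)) := by
    intro ξ
    have := hνD (τ (codil hA (-1) ξ))
    rwa [hD, ← codil_add, add_neg_cancel, codil_zero] at this
  induction p with
  | zero => intro ξ; simp [codil_zero]
  | succ p ih =>
    intro ξ
    have h1 : codil hA (-((p + 1 : ℕ) : ℤ)) ξ = codil hA (-1) (codil hA (-p) ξ) := by
      rw [← codil_add]
      congr 2
      push_cast
      ring
    rw [h1]
    calc l ^ (p + 1) * ν (τ ξ) = l * (l ^ p * ν (τ ξ)) := by ring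
      _ ≤ l * ν (τ (codil hA (-p) ξ)) := by gcongr; exact ih ξ
      _ ≤ _ := hstep _

end MatrixDilation

/-! ### Band-limited squeezing and the multiresolution axioms. -/

section MRA

variable {n N : ℕ} {A : Matrix (Fin n) (Fin n) ℝ} {Γ : Submodule ℤ (RSpace n)}

/-- A closed subspace squeezed between two spaces of band-limited functions, the larger of which
is contained in a dilate of the smaller one, generates a multiresolution analysis. -/
theorem isMRA_comap_dil (hn : 1 ≤ n) (hA : IsUnit A.det) {τ : RSpace n ≃L[ℝ] (Fin n → ℝ)}
    {ν : Seminorm ℝ (Fin n → ℝ)} (hνc : Continuous ν) (hν : ∀ x, ‖x‖ ≤ ν x) {l : ℝ} (hl : 1 < l)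
    (hexp : ∀ (p : ℕ) ξ, l ^ p * ν (τ ξ) ≤ ν (τ (codil hA (-p) ξ))) {r₁ r₃ : ℝ} (hr₁ : 0 < r₁)
    (hr₃ : r₃ ≤ l * r₁) {V : Submodule ℂ (L2Space n)} (hVc : IsClosed (V : Set (L2Space n)))
    (hV₁ : fourierZeroOn {ξ | r₁ ≤ ν (τ ξ)} ≤ V) (hV₃ : V ≤ fourierZeroOn {ξ | r₃ ≤ ν (τ ξ)})
    {Φ : Fin N → L2Space n} (hΦ : IsScalingVector Γ V Φ) :
    IsMRA A Γ N (fun j => V.comap (compL2 (dil hA (-j))).toLinearMap) := by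
  have hνinv : ∀ r, MeasurableSet {ξ : RSpace n | r ≤ ν (τ ξ)} := fun r =>
    (isClosed_le continuous_const (hνc.comp τ.continuous)).measurableSet
  have hcinv : ∀ r j, MeasurableSet (codil hA j ⁻¹' {ξ : RSpace n | r ≤ ν (τ ξ)}) := fun r j =>
    (codil hA j).continuous.measurable (hνinv r)
  have hmem : ∀ j f, f ∈ V.comap (compL2 (dil hA (-j))).toLinearMap ↔
      compL2 (dil hA (-j)) f ∈ V := fun _ _ => Iff.rfl
  have hV0 : V.comap (compL2 (dil hA (-0))).toLinearMap = V := by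
    ext f
    rw [hmem, neg_zero, compL2_dil_zero]
  refine ⟨fun j => hVc.preimage (compL2 (dil hA (-j))).continuous, fun j f hf => ?_, ?_, ?_,
    fun j f => ?_, ?_⟩
  · rw [hmem] at hf ⊢
    have h1 : compL2 (dil hA (-(j + 1))) f = compL2 (dil hA (-1)) (compL2 (dil hA (-j)) f) := by
      rw [compL2_dil_add, neg_add]
    rw [h1]
    refine hV₁ (fourierZeroOn_mono (hcinv r₃ (-1)) (hνinv r₁) (fun ξ hξ => ?_)
      (compL2_dil_mem_fourierZeroOn hA (hνinv r₃) (hV₃ hf) (-1)))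
    have h2 := hexp 1 ξ
    simp only [Set.mem_preimage, Set.mem_ofPred_eq, pow_one, Nat.cast_one] at h2 hξ ⊢
    calc r₃ ≤ l * r₁ := hr₃
      _ ≤ l * ν (τ ξ) := by gcongr
      _ ≤ _ := h2
  · ext f
    simp only [Set.mem_iInter, SetLike.mem_coe, Set.mem_singleton_iff]
    refine ⟨fun hf => ?_, fun hf j => by rw [hf]; exact Submodule.zero_mem _⟩
    -- The frequency supports allowed in `V_{-p}` shrink to the origin, a null set because `n ≥ 1`.
    have h1 : ∀ p : ℕ, ∀ᵐ ξ, r₃ ≤ ν (τ (codil hA (-p) ξ)) → (𝓕 f : L2Space n) ξ = 0 := by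
      intro p
      have h2 := compL2_dil_mem_fourierZeroOn hA (hνinv r₃) (hV₃ ((hmem _ _).1 (hf (-p)))) (-p)
      rw [compL2_dil_neg, mem_fourierZeroOn (hcinv r₃ _)] at h2
      exact h2
    have hnt : Nontrivial (RSpace n) := by
      have : Nonempty (Fin n) := ⟨⟨0, hn⟩⟩
      infer_instance
    have h3 : ∀ᵐ ξ : RSpace n, ξ ≠ 0 := by
      rw [ae_iff]
      simp
    have h4 : (𝓕 f : L2Space n) = 0 := by
      rw [Lp.eq_zero_iff_ae_eq_zero]
      filter_upwards [ae_all_iff.2 h1, h3] with ξ h5 h6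
      have h7 : 0 < ν (τ ξ) := lt_of_lt_of_le (norm_pos_iff.2 (by simpa using h6)) (hν _)
      obtain ⟨p, hp⟩ := pow_unbounded_of_one_lt (r₃ / ν (τ ξ)) hl
      rw [div_lt_iff₀ h7] at hp
      exact h5 p (hp.le.trans (hexp p ξ))
    exact (Lp.fourierTransformₗᵢ (RSpace n) ℂ).map_eq_zero_iff.1 h4
  · refine Set.eq_univ_of_forall fun f => Metric.mem_closure_iff.2 fun ε hε => ?_
    -- Functions with compactly supported transform are dense, and each lies in some `V_p`, as `l ^
    -- p * r₁` is unbounded.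
    obtain ⟨g, hgc, hgε, -, hg2⟩ := (Lp.memLp (𝓕 f : L2Space n)).exists_hasCompactSupport_eLpNorm_sub_le
      ENNReal.ofNat_ne_top (ε := ENNReal.ofReal (ε / 2)) (by simpa using hε)
    set F : L2Space n := (Lp.fourierTransformₗᵢ (RSpace n) ℂ).symm (hg2.toLp g) with hF
    have hFF : (𝓕 F : L2Space n) = hg2.toLp g :=
      (Lp.fourierTransformₗᵢ (RSpace n) ℂ).apply_symm_apply _
    have hdist : dist f F < ε := by
      rw [← (Lp.fourierTransformₗᵢ (RSpace n) ℂ).dist_map f F]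
      change dist (𝓕 f : L2Space n) (𝓕 F : L2Space n) < ε
      rw [hFF, ← Lp.toLp_coeFn (𝓕 f : L2Space n) (Lp.memLp _), dist_eq_norm,
        ← MemLp.toLp_sub, Lp.norm_toLp]
      refine lt_of_le_of_lt (ENNReal.toReal_le_of_le_ofReal (by positivity) hgε) (by linarith)
    obtain ⟨ρ, hρ⟩ := hgc.isCompact.exists_bound_of_continuousOn
      (f := fun ξ => ν (τ ξ)) (hνc.comp τ.continuous).continuousOn
    have hFz : F ∈ fourierZeroOn {ξ | ρ + 1 ≤ ν (τ ξ)} := by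
      rw [mem_fourierZeroOn (hνinv _), hFF]
      filter_upwards [hg2.coeFn_toLp] with ξ hξ hξ2
      rw [hξ]
      by_contra h
      have := (le_abs_self _).trans (hρ ξ (subset_tsupport _ h))
      have : ρ + 1 ≤ ν (τ ξ) := hξ2
      linarith
    obtain ⟨p, hp⟩ := pow_unbounded_of_one_lt ((ρ + 1) / r₁) hl
    rw [div_lt_iff₀ hr₁] at hp
    refine ⟨F, Set.mem_iUnion.2 ⟨p, (hmem _ _).2 (hV₁ ?_)⟩, hdist⟩
    refine fourierZeroOn_mono (hcinv (ρ + 1) (-p)) (hνinv r₁) (fun ξ hξ => ?_)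
      (compL2_dil_mem_fourierZeroOn hA (hνinv _) hFz (-p))
    simp only [Set.mem_preimage, Set.mem_ofPred_eq] at hξ ⊢
    calc ρ + 1 ≤ l ^ p * r₁ := hp.le
      _ ≤ l ^ p * ν (τ ξ) := by gcongr
      _ ≤ _ := hexp p ξ
  · have hback : compL2 (dil hA (-j)) (compL2 (dil hA j) f) = f := by
      rw [compL2_dil_add, add_neg_cancel, compL2_dil_zero]
    rw [hV0]
    constructor
    · intro hf
      refine ⟨compL2 (dil hA j) f, ?_, coeFn_compL2 (dil hA j) f⟩
      rw [hmem, hback]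
      exact hf
    · rintro ⟨g, hg, hgf⟩
      have : g = compL2 (dil hA j) f := Lp.ext (hgf.trans (coeFn_compL2 (dil hA j) f).symm)
      rw [hmem, this, hback] at hg
      exact hg
  · rw [hV0]
    exact ⟨Φ, hΦ⟩

end MRA

/-- Every real expansive dilation `A` and every full rank lattice `Γ` in `ℝⁿ`, `n ≥ 1`, admit an
`(A, Γ)`-multiresolution analysis with Schwartz scaling functions whose Fourier transforms
`ξ ↦ ∫ φ(x) e^{-2πi⟨x, ξ⟩} dx` are real-valued, smooth and compactly supported. -/
theorem theorem3p2 (n : ℕ) (hn : 1 ≤ n) (A : Matrix (Fin n) (Fin n) ℝ) (hA : IsExpansive A)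
    (Γ : Submodule ℤ (RSpace n)) [DiscreteTopology Γ] [IsZLattice ℝ Γ] :
    ∃ N : ℕ, 1 ≤ N ∧ ∃ V : ℤ → Submodule ℂ (L2Space n), IsMRA A Γ N V ∧
      ∃ φ : Fin N → 𝓢(RSpace n, ℂ),
        IsScalingVector Γ (V 0) (fun i => (φ i).toLp 2 volume) ∧
        ∀ i, (∀ ξ : RSpace n, (𝓕 (φ i : RSpace n → ℂ) ξ).im = 0) ∧
          ContDiff ℝ ∞ (𝓕 (φ i : RSpace n → ℂ)) ∧
          HasCompactSupport (𝓕 (φ i : RSpace n → ℂ)) := by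
  have hdet := hA.isUnit_det
  obtain ⟨b, τ, hτ⟩ := exists_lattice_coordinates Γ
  obtain ⟨l, hl, ν, hνc, hν, hexp⟩ := exists_adapted_seminorm_of_isExpansive hdet hn hA τ
  obtain ⟨C, hC⟩ := (isCompact_Icc (a := (0 : Fin n → ℝ)) (b := 1)).exists_bound_of_continuousOn
    hνc.continuousOn
  have hC' : ∀ x : Fin n → ℝ, (∀ j, 0 ≤ x j ∧ x j ≤ 1) → ν x ≤ C := fun x hx =>
    (le_abs_self _).trans (hC x ⟨fun j => (hx j).1, fun j => (hx j).2⟩)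
  have hC0 : 0 ≤ C := by simpa using hC' 0 (by simp)
  have hl0 : 0 < l - 1 := sub_pos.2 hl
  -- Chosen so that `l * r₁ = r₁ + 2 * C + 1`, which meets both the counting condition and the
  -- squeezing condition.
  set r₁ : ℝ := (2 * C + 1) / (l - 1) with hr₁
  have hr₁0 : 0 < r₁ := by positivity
  have hr₁l : (l - 1) * r₁ = 2 * C + 1 := mul_div_cancel₀ _ hl0.ne'
  obtain ⟨N, hN, g, hg1, hg2, hg3, hg4⟩ := exists_smooth_frame ν hνc hν hC' (r₁ := r₁)
    (r₃ := l * r₁) hr₁0.le (by linarith)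
  have hg : IsSmoothFrame ν r₁ (l * r₁) g := ⟨hg1, hg2, hg3, hg4⟩
  obtain ⟨c, hc0, hct, hc⟩ := exists_map_eq_smul_volume τ
  have hcpos : 0 < c.toReal := ENNReal.toReal_pos hc0 hct
  -- Compensates for the factor by which `τ` scales Lebesgue measure.
  set κ : ℝ := (√c.toReal)⁻¹ with hκ
  have hκ0 : κ ≠ 0 := (inv_pos.2 (Real.sqrt_pos.2 hcpos)).ne'
  have hκc : κ ^ 2 * c.toReal = 1 := by
    rw [hκ, inv_pow, Real.sq_sqrt hcpos.le, inv_mul_cancel₀ hcpos.ne']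
  choose φ hφ hφc using fun i => hg.exists_schwartzMap hν κ τ i
  set V := (Submodule.span ℂ
    (Set.range (translates Γ (fun i => (φ i).toLp 2 volume)))).topologicalClosure with hV
  have hscal : IsScalingVector Γ V (fun i => (φ i).toLp 2 volume) := by
    refine ⟨fun i => ?_, hg.orthonormal_translates hν hτ hc hκc hφ, rfl⟩
    refine Submodule.le_topologicalClosure _ (Submodule.subset_span ⟨(0, i), ?_⟩)
    simp [translates, translateL2_toLp, SchwartzMap.compSubConstCLM_zero]
  have hmra := isMRA_comap_dil hn hdet hνc hν hl hexp hr₁0 le_rfl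
    (Submodule.isClosed_topologicalClosure _)
    (hg.fourierZeroOn_le_closure_span_translates hν hνc hτ hκ0 hφ)
    (hg.closure_span_translates_le hνc hτ hφ) hscal
  refine ⟨N, hN, _, hmra, φ, ?_, fun i => ⟨fun ξ => ?_, ?_, ?_⟩⟩
  · have hV0 : V.comap (compL2 (dil hdet (-0))).toLinearMap = V := by
      ext f
      change compL2 (dil hdet (-0)) f ∈ V ↔ _
      rw [neg_zero, compL2_dil_zero]
    rw [hV0]
    exact hscal
  · rw [← SchwartzMap.fourier_coe, hφ]
    exact Complex.ofReal_im _
  · rw [← SchwartzMap.fourier_coe]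
    exact (𝓕 (φ i) : 𝓢(RSpace n, ℂ)).smooth ⊤
  · rw [← SchwartzMap.fourier_coe]
    exact hφc i
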